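/- **Notation.** For a real Banach space $\mathcal X$, $\Gamma_0(\mathcal X)$ is the set of lower semicontinuous convex functions $f\colon\mathcal X\to\left]-\infty,+\infty\right]$ with $\operatorname{dom}f=\{x : f(x)<+\infty\}\neq\varnothing$; $f^*$ is the conjugate and $\partial f$ the subdifferential of $f$; $f$ is cofinite if $\operatorname{dom}f^*=\mathcal X^*$. If $f$ is Gâteaux differentiable on $\operatorname{int}\operatorname{dom}f$, its Bregman distance is $D^f(x,y)=f(x)-f(y)-\langle x-y,\nabla f(y)\rangle$ if $y\in\operatorname{int}\operatorname{dom}f$, and $D^f(x,y)=+\infty$ otherwise. $f$ is a Legendre function if it is Gâteaux differentiable on $\operatorname{int}\operatorname{dom}f\neq\varnothing$, $\partial f$ is locally bounded and single-valued on its domain, $\partial f^*$ is locally bounded on its domain, and $f$ is strictly convex on every convex subset of $\operatorname{dom}\partial f$. A function $h\colon\mathcal X\to\left]-\infty,+\infty\right]$ is coercive if $h(z)\to+\infty$ as $\|z\|\to+\infty$. We write $f\succcurlyeq g$ if $g$ is Gâteaux differentiable at every point of $\operatorname{int}\operatorname{dom}f$ (these being interior points of $\operatorname{dom} g$) and $D^f(x,y)\ge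 D^g(x,y)$ for all $x\in\operatorname{dom}f$ and $y\in\operatorname{int}\operatorname{dom}f$. Finally, $$\operatorname{Prox}^f_\varphi(x^*)=\Big\{x\in\mathcal X : \varphi(x)+f(x)-\langle x,x^*\rangle=\min_{z\in\mathcal X}\big(\varphi(z)+f(z)-\langle z,x^*\rangle\big)<+\infty\Big\},$$ and $\nabla f$ is called weakly sequentially continuous if $z_n\rightharpoonup z$ with all $z_n$ and $z$ in $\operatorname{int}\operatorname{dom}f$ implies $\nabla f(z_n)\rightharpoonup\nabla f(z)$. **Proposition.** Let $m,p\ge1$ be integers and let $(\mathcal X_i)_{1\le i\le m}$, $(\mathcal Y_k)_{1\le k\le p}$ be reflexive real Banach spaces. For all $i,k$ let $\varphi_i\in\Gamma_0(\mathcal X_i)$, let $\psi_k\in\Gamma_0(\mathcal Y_k)$ be Gâteaux differentiable on $\operatorname{int}\operatorname{dom}\psi_k\ne\varnothing$, and let $L_{ik}\colon\mathcal X_i\to\mathcal Y_k$ be linear and bounded. Let $F$ be the set of solutions (minimizers with finite objective value) of $$\operatorname*{minimize}_{x_1\in\mathcal X_1,\dots,x_m\in\mathcal X_m}\ \sum_{i=1}^m\varphi_i(x_i)+\sum_{k=1}^p\psi_k\Big(\sum_{i=1}^mL_{ik}x_i\Big).$$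 For every $k$ let $\sigma_k>0$ be such that $$D^{\psi_k}\Big(\sum_{i=1}^my_i,\sum_{i=1}^mv_i\Big)\le\sigma_k\sum_{i=1}^mD^{\psi_k}(y_i,v_i)$$ for all $y_1,\dots,y_m,v_1,\dots,v_m\in\operatorname{int}\operatorname{dom}\psi_k$ with $\sum_iy_i,\sum_iv_i\in\operatorname{int}\operatorname{dom}\psi_k$. For every $i$ let $f_i\in\Gamma_0(\mathcal X_i)$ be a Legendre function such that $D^{f_i}(x_i,\cdot)$ is coercive for every $x_i\in\operatorname{int}\operatorname{dom}f_i$. Suppose that, for every $k$, $\sum_{i=1}^mL_{ik}(\operatorname{int}\operatorname{dom}f_i)\subset\operatorname{int}\operatorname{dom}\psi_k$; that $f_i\succcurlyeq\beta_{ik}\,\psi_k\circ L_{ik}$ for every $i,k$, where $\beta_{ik}>0$; that $F\cap\prod_{i}\operatorname{int}\operatorname{dom}f_i\neq\varnothing$; and that either all the $f_i$ are cofinite or all the $\varphi_i$ are cofinite. Set $\beta_k=\min_{i}\beta_{ik}$ and $S=\sum_{k=1}^p\sigma_k\beta_k^{-1}$. Let $\varepsilon\in\left]0,1/(1+S)\right[$,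 let $(\eta_n)_{n\in\mathbb N}$ be a summable sequence in $\left[0,+\infty\right[$, and let $(\gamma_n)_{n\in\mathbb N}$ be real numbers such that, for every $n\in\mathbb N$, $$\varepsilon\le\gamma_n\le\frac{1-\varepsilon}{S}\quad\text{and}\quad(1+\eta_n)\gamma_n-\gamma_{n+1}\le\frac{\eta_n}{S}.$$ Let $(x_{i,0})_{i}\in\prod_{i}\operatorname{int}\operatorname{dom}f_i$ and iterate, for $n=0,1,\dots$ and $i=1,\dots,m$, $$x_{i,n+1}=\operatorname{Prox}^{f_i}_{\gamma_n\varphi_i}\Big(\nabla f_i(x_{i,n})-\gamma_n\sum_{k=1}^pL_{ik}^*\nabla\psi_k\Big(\sum_{j=1}^mL_{jk}x_{j,n}\Big)\Big).$$ Then the iteration is well defined (every $x_{i,n}$ lies in $\operatorname{int}\operatorname{dom}f_i$ and each set $\operatorname{Prox}^{f_i}_{\gamma_n\varphi_i}(\cdot)$ above is a singleton), and there exists $(\overline x_i)_{1\le i\le m}\in F$ such that the following hold. 1. If $F\cap\prod_{i}\overline{\operatorname{dom}f_i}$ is a singleton, then $x_{i,n}\rightharpoonup\overline x_i$ for every $i$.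 2. Suppose that all $\nabla f_i$ and all $\nabla\psi_k$ are weakly sequentially continuous and that, for every $i$, one of the following holds: (a) $\operatorname{dom}\varphi_i\subset\operatorname{int}\operatorname{dom}f_i$; (b) $\operatorname{dom}f_i^*$ is open and $\nabla f_i^*$ is weakly sequentially continuous. Then $x_{i,n}\rightharpoonup\overline x_i$ for every $i$. -/

import Mathlib

open Filter Topology

noncomputable section

namespace BregmanFB

variable {E : Type*} [NormedAddCommGroup E] [NormedSpace ℝ E]

/-- Reflexivity: the canonical embedding into the bidual is onto. -/
def IsReflexiveSpace (E : Type*) [NormedAddCommGroup E] [NormedSpace ℝ E] : Prop :=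
  Function.Surjective (NormedSpace.inclusionInDoubleDual ℝ E)

/-- Weak convergence of a sequence. -/
def WeakTendsto (u : ℕ → E) (x : E) : Prop :=
  Tendsto (fun n => toWeakSpace ℝ E (u n)) atTop (𝓝 (toWeakSpace ℝ E x))

/-- The effective domain `{x | f x < +∞}`. -/
def effDom (f : E → EReal) : Set E := {x | f x < ⊤}

/-- `Γ₀(E)`: proper lower semicontinuous convex functions with values in `]-∞, +∞]`. -/
structure IsGammaZero (f : E → EReal) : Prop where
  ne_bot : ∀ x, f x ≠ ⊥
  dom_nonempty : (effDom f).Nonempty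
  lsc : LowerSemicontinuous f
  convex : ∀ x y : E, ∀ a b : ℝ, 0 < a → 0 < b → a + b = 1 →
    f (a • x + b • y) ≤ (a : EReal) * f x + (b : EReal) * f y

/-- `g` is the Gâteaux gradient of `f` at `y`, a point of `int dom f`. -/
def HasGateauxGradAt (f : E → EReal) (g : StrongDual ℝ E) (y : E) : Prop :=
  y ∈ interior (effDom f) ∧
    ∀ h : E, HasLineDerivAt ℝ (fun z => (f z).toReal) (g h) y h

/-- Gâteaux differentiability at a point of the interior of the domain. -/
def GateauxDiffAt (f : E → EReal) (y : E) : Prop := ∃ g, HasGateauxGradAt f g y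

open Classical in
/-- The Gâteaux gradient `∇f(y)` (with the value `0` where `f` is not Gâteaux differentiable). -/
def grad (f : E → EReal) (y : E) : StrongDual ℝ E :=
  if h : GateauxDiffAt f y then h.choose else 0

open Classical in
/-- The Bregman distance `D^f(x, y)`. -/
def bregman (f : E → EReal) (x y : E) : EReal :=
  if y ∈ interior (effDom f) then f x - f y - ((grad f y (x - y) : ℝ) : EReal) else ⊤

/-- The Fenchel conjugate `f*`. -/
def conj (f : E → EReal) (u : StrongDual ℝ E) : EReal :=
  ⨆ x : E, ((u x : ℝ) : EReal) - f x

/-- The Moreau subdifferential. -/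
def subdiff (f : E → EReal) (x : E) : Set (StrongDual ℝ E) :=
  {u | ∀ y : E, ((u (y - x) : ℝ) : EReal) + f x ≤ f y}

/-- The domain of the subdifferential. -/
def domSubdiff (f : E → EReal) : Set E := {x | (subdiff f x).Nonempty}

/-- `∂f` is locally bounded on its domain. -/
def SubdiffLocallyBounded (f : E → EReal) : Prop :=
  ∀ x ∈ domSubdiff f, ∃ U ∈ 𝓝 x, Bornology.IsBounded (⋃ z ∈ U, subdiff f z)

/-- Legendre functions on a reflexive space: `f` is Gâteaux differentiable on
`int dom f ≠ ∅`, essentially smooth and essentially strictly convex.  The subdifferential of `f*`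
is taken in the bidual, which reflexivity identifies with `E`. -/
structure IsLegendre (f : E → EReal) : Prop where
  interior_nonempty : (interior (effDom f)).Nonempty
  gateaux : ∀ y ∈ interior (effDom f), GateauxDiffAt f y
  subdiff_bounded : SubdiffLocallyBounded f
  subdiff_single : ∀ x ∈ domSubdiff f, (subdiff f x).Subsingleton
  conj_subdiff_bounded : SubdiffLocallyBounded (conj f)
  strictConvex : ∀ C : Set E, Convex ℝ C → C ⊆ domSubdiff f →
    ∀ x ∈ C, ∀ y ∈ C, x ≠ y → ∀ a b : ℝ, 0 < a → 0 < b → a + b = 1 →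
      f (a • x + b • y) < (a : EReal) * f x + (b : EReal) * f y

/-- `h` is coercive: `h(z) → +∞` as `‖z‖ → +∞`. -/
def IsCoerciveFun (h : E → EReal) : Prop := Tendsto h (Bornology.cobounded E) (𝓝 ⊤)

/-- `f` is cofinite: `dom f* = E*`. -/
def IsCofinite (f : E → EReal) : Prop := effDom (conj f) = Set.univ

/-- The relation `f ≽ g`: `D^f(x, y) ≥ D^g(x, y)` for all `x ∈ dom f` and `y ∈ int dom f`,
where `g` is Gâteaux differentiable at the points of `int dom f`
(which are, in particular, interior points of `dom g`). -/
def BregmanGE (f g : E → EReal) : Prop :=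
  (∀ y ∈ interior (effDom f), GateauxDiffAt g y) ∧
    ∀ x ∈ effDom f, ∀ y ∈ interior (effDom f), bregman g x y ≤ bregman f x y

/-- The `f`-proximity operator of `φ`, as a set-valued operator on the dual. -/
def prox (f φ : E → EReal) (u : StrongDual ℝ E) : Set E :=
  {x | φ x + f x - ((u x : ℝ) : EReal) < ⊤ ∧
    ∀ y : E, φ x + f x - ((u x : ℝ) : EReal) ≤ φ y + f y - ((u y : ℝ) : EReal)}

/-- `∇f : int dom f → E*` is weakly sequentially continuous. -/
def GradWeakSeqCont (f : E → EReal) : Prop :=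
  ∀ (u : ℕ → E) (x : E), (∀ n, u n ∈ interior (effDom f)) → x ∈ interior (effDom f) →
    WeakTendsto u x → WeakTendsto (fun n => grad f (u n)) (grad f x)

section Multivariate

variable {ι κ : Type*} [Fintype ι] [Fintype κ] {X : ι → Type*} {Y : κ → Type*}
  [∀ i, NormedAddCommGroup (X i)] [∀ i, NormedSpace ℝ (X i)]
  [∀ k, NormedAddCommGroup (Y k)] [∀ k, NormedSpace ℝ (Y k)]

/-- `∑ᵢ φᵢ(xᵢ) + ∑ₖ ψₖ(∑ᵢ Lᵢₖ xᵢ)`. -/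
def objective (φ : ∀ i, X i → EReal) (ψ : ∀ k, Y k → EReal)
    (L : ∀ i k, X i →L[ℝ] Y k) (x : ∀ i, X i) : EReal :=
  ∑ i, φ i (x i) + ∑ k, ψ k (∑ i, L i k (x i))

/-- The solution set: the points where the objective attains its minimum, with a finite value. -/
def solutions (φ : ∀ i, X i → EReal) (ψ : ∀ k, Y k → EReal)
    (L : ∀ i k, X i →L[ℝ] Y k) : Set (∀ i, X i) :=
  {x | objective φ ψ L x < ⊤ ∧ ∀ y, objective φ ψ L x ≤ objective φ ψ L y}

/-- The point `∇fᵢ(xᵢ) - γ ∑ₖ Lᵢₖ* ∇ψₖ(∑ⱼ Lⱼₖ xⱼ)` of `Xᵢ*`. -/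
def forwardStep (f : ∀ i, X i → EReal) (ψ : ∀ k, Y k → EReal)
    (L : ∀ i k, X i →L[ℝ] Y k) (γ : ℝ) (x : ∀ i, X i) (i : ι) : StrongDual ℝ (X i) :=
  grad (f i) (x i) - γ • ∑ k, (grad (ψ k) (∑ j, L j k (x j))).comp (L i k)

/-- `x` is generated by the block-separable forward-backward iteration started at `x₀`:
at every step the proximity operator is single-valued at the forward step, with value `xᵢ,ₙ₊₁`. -/
def IsForwardBackward (f φ : ∀ i, X i → EReal) (ψ : ∀ k, Y k → EReal)
    (L : ∀ i k, X i →L[ℝ] Y k) (γ : ℕ → ℝ) (x₀ : ∀ i, X i) (x : ℕ → ∀ i, X i) : Prop :=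
  x 0 = x₀ ∧ ∀ n i,
    prox (f i) (fun z => (γ n : EReal) * φ i z) (forwardStep f ψ L (γ n) (x n) i) = {x (n + 1) i}

end Multivariate

end BregmanFB

end

open BregmanFB

noncomputable section

namespace BregmanFB

/-! ### Convexity in real terms; local upper bounds by Baire. -/

section Basics

variable {E : Type*} [NormedAddCommGroup E] [NormedSpace ℝ E] {f g : E → EReal}

/-! Write D for the sum of the Bregman distances of the `f i`, and Φ for the objective. Everything
rests on one inequality (`descent_step`): if x' is the step from x with parameter γ, then for every
z in dom Φ, γ(Φ(x') - Φ(z)) + D(z, x') + (1 - γS) D(x', x) ≤ D(z, x). It adds the subgradient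
inequalities for φ at x' (optimality in the proximal step), the three-point identity, convexity of ψ
at ∑ L x, and the relative smoothness bound ∑ D^ψ(∑ L x', ∑ L x) ≤ S D(x', x). For a solution z in
the domains of the `f i`, the bounds on γ make D(z, x_n) nonincreasing and force Φ(x_n) → min Φ.
Coercivity of D at an interior solution bounds the orbit, and weak lower semicontinuity makes every
weak cluster point a solution.

It remains to see that there is a single cluster point. All of them lie in the closures of the
domains, which settles assertion 1. For assertion 2, they lie in the interiors of the domains:
directly under (a), by passing to the conjugate under (b)
(`IsLegendre.mem_interior_of_weakTendsto`). If y and z are two of them, D(y, x_n) - D(z, x_n)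
converges, hence so does ∇f(x_n) applied to y - z; weak continuity of ∇f identifies the limit along
both subsequences, so D(y, z) + D(z, y) = 0 and y = z.

Two points need care. The subadditivity hypothesis on D^ψ concerns interior points, whereas a single
`L i k (x i)` may lie on the boundary of dom ψ; `IsGammaZero.realBregman_sum_le` extends it by a
double limit. Well-definedness uses cofiniteness to make the proximal objective coercive,
reflexivity to get a minimizer, and the Legendre property to place it in the interior and to make it
unique. -/

theorem mem_effDom_of_le {E : Type*} {f : E → EReal} {x : E} {r : ℝ} (h : f x ≤ r) : x ∈ effDom f :=
  lt_of_le_of_lt h (EReal.coe_lt_top r)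

theorem IsGammaZero.coe_toReal (hf : IsGammaZero f) {x : E} (hx : x ∈ effDom f) :
    ((f x).toReal : EReal) = f x :=
  EReal.coe_toReal (ne_of_lt hx) (hf.ne_bot x)

theorem IsGammaZero.le_coe_iff (hf : IsGammaZero f) {x : E} (hx : x ∈ effDom f) {r : ℝ} :
    f x ≤ r ↔ (f x).toReal ≤ r := by
  rw [← hf.coe_toReal hx, EReal.coe_le_coe_iff, EReal.toReal_coe]

theorem IsGammaZero.comb_le (hf : IsGammaZero f) {x y : E} {r s a b : ℝ} (ha : 0 ≤ a)
    (hb : 0 ≤ b) (hab : a + b = 1) (hx : f x ≤ r) (hy : f y ≤ s) :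
    f (a • x + b • y) ≤ ((a * r + b * s : ℝ) : EReal) := by
  rcases ha.eq_or_lt with rfl | ha
  · obtain rfl : b = 1 := by linarith
    simpa using hy
  rcases hb.eq_or_lt with rfl | hb
  · obtain rfl : a = 1 := by linarith
    simpa using hx
  refine (hf.convex x y a b ha hb hab).trans ?_
  push_cast
  exact add_le_add (mul_le_mul_of_nonneg_left hx (EReal.coe_nonneg.2 ha.le))
    (mul_le_mul_of_nonneg_left hy (EReal.coe_nonneg.2 hb.le))

/-- Convexity may be checked through upper bounds by real numbers. -/
theorem IsGammaZero.of_comb_le (hbot : ∀ x, f x ≠ ⊥) (hdom : (effDom f).Nonempty)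
    (hlsc : LowerSemicontinuous f)
    (h : ∀ (x y : E) (r s a b : ℝ), 0 < a → 0 < b → a + b = 1 → f x ≤ r → f y ≤ s →
      f (a • x + b • y) ≤ ((a * r + b * s : ℝ) : EReal)) : IsGammaZero f := by
  refine ⟨hbot, hdom, hlsc, fun x y a b ha hb hab => ?_⟩
  have hne : ∀ (c : ℝ) (z : E), 0 < c → (c : EReal) * f z ≠ ⊥ := fun c z hc => by
    rw [EReal.mul_ne_bot]
    simp [hbot z, hc.le]
  by_cases hx : f x = ⊤
  · rw [hx, EReal.coe_mul_top_of_pos ha, EReal.top_add_of_ne_bot (hne b y hb)]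
    exact le_top
  by_cases hy : f y = ⊤
  · rw [hy, EReal.coe_mul_top_of_pos hb, EReal.add_top_of_ne_bot (hne a x ha)]
    exact le_top
  rw [← EReal.coe_toReal hx (hbot x), ← EReal.coe_toReal hy (hbot y)]
  have := h x y (f x).toReal (f y).toReal a b ha hb hab
    (EReal.coe_toReal hx (hbot x)).ge (EReal.coe_toReal hy (hbot y)).ge
  simpa using this

theorem IsGammaZero.comb_mem (hf : IsGammaZero f) {x y : E} {a b : ℝ} (ha : 0 ≤ a)
    (hb : 0 ≤ b) (hab : a + b = 1) (hx : x ∈ effDom f) (hy : y ∈ effDom f) :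
    a • x + b • y ∈ effDom f :=
  mem_effDom_of_le (hf.comb_le ha hb hab (hf.coe_toReal hx).ge (hf.coe_toReal hy).ge)

theorem IsGammaZero.convex_effDom (hf : IsGammaZero f) : Convex ℝ (effDom f) :=
  fun _ hx _ hy _ _ ha hb hab => hf.comb_mem ha hb hab hx hy

theorem IsGammaZero.toReal_comb_le (hf : IsGammaZero f) {x y : E} {a b : ℝ} (ha : 0 ≤ a)
    (hb : 0 ≤ b) (hab : a + b = 1) (hx : x ∈ effDom f) (hy : y ∈ effDom f) :
    (f (a • x + b • y)).toReal ≤ a * (f x).toReal + b * (f y).toReal :=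
  (hf.le_coe_iff (hf.comb_mem ha hb hab hx hy)).1
    (hf.comb_le ha hb hab (hf.coe_toReal hx).ge (hf.coe_toReal hy).ge)

/-- The real epigraph `{(x, s) | f x ≤ s}`. -/
def realEpi (f : E → EReal) : Set (E × ℝ) := {p | f p.1 ≤ (p.2 : EReal)}

theorem IsGammaZero.convex_realEpi (hf : IsGammaZero f) : Convex ℝ (realEpi f) :=
  fun _ hx _ hy _ _ ha hb hab => hf.comb_le ha hb hab hx hy

theorem IsGammaZero.isClosed_realEpi (hf : IsGammaZero f) : IsClosed (realEpi f) :=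
  hf.lsc.isClosed_epigraph.preimage
    (continuous_fst.prodMk (continuous_coe_real_ereal.comp continuous_snd))

theorem mem_subdiff_iff (hf : IsGammaZero f) {x : E} (hx : x ∈ effDom f) {u : StrongDual ℝ E} :
    u ∈ subdiff f x ↔ ∀ y ∈ effDom f, u (y - x) + (f x).toReal ≤ (f y).toReal := by
  constructor
  · intro h y hy
    have := h y
    rw [← hf.coe_toReal hx, ← hf.coe_toReal hy] at this
    exact_mod_cast this
  · intro h y
    by_cases hy : y ∈ effDom f
    · have := h y hy
      rw [← hf.coe_toReal hx, ← hf.coe_toReal hy]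
      exact_mod_cast this
    · have : f y = ⊤ := by simpa [effDom] using hy
      simp [this]

theorem IsGammaZero.mem_effDom_of_mem_subdiff (hf : IsGammaZero f) {x : E} {u : StrongDual ℝ E}
    (hu : u ∈ subdiff f x) : x ∈ effDom f := by
  obtain ⟨y, hy⟩ := hf.dom_nonempty
  by_contra hx
  have hx' : f x = ⊤ := by simpa [effDom] using hx
  have := hu y
  rw [hx', EReal.coe_add_top] at this
  exact absurd (lt_of_le_of_lt this hy) (lt_irrefl _)

theorem IsGammaZero.subdiff_le (hf : IsGammaZero f) {x y : E} {u : StrongDual ℝ E}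
    (hu : u ∈ subdiff f x) (hy : y ∈ effDom f) :
    u (y - x) + (f x).toReal ≤ (f y).toReal :=
  (mem_subdiff_iff hf (hf.mem_effDom_of_mem_subdiff hu)).1 hu y hy

/-- A lower semicontinuous convex function on a Banach space is bounded above near the interior
points of its domain. -/
theorem IsGammaZero.exists_ball_le [CompleteSpace E] (hf : IsGammaZero f) {x : E}
    (hx : x ∈ interior (effDom f)) :
    ∃ r > 0, ∃ M : ℝ, ∀ y ∈ Metric.ball x r, f y ≤ M := by
  obtain ⟨R, hR, hball⟩ := Metric.mem_nhds_iff.1 (mem_interior_iff_mem_nhds.1 hx)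
  have hxd : x ∈ effDom f := interior_subset hx
  set M : ℝ := (f x).toReal + 1 with hM
  -- Closed sets of directions along which f stays below M both forwards and backwards at scale
  -- 1/(n+1). They cover the space, so by Baire one of them contains a ball.
  let K : ℕ → Set E := fun n =>
    {h | f (x + ((n : ℝ) + 1)⁻¹ • h) ≤ M} ∩ {h | f (x - ((n : ℝ) + 1)⁻¹ • h) ≤ M}
  have hKc : ∀ n, IsClosed (K n) := fun n =>
    ((hf.lsc.isClosed_preimage M).preimage (by fun_prop)).inter
      ((hf.lsc.isClosed_preimage M).preimage (by fun_prop))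
  have key : ∀ h : E, ∀ᶠ n : ℕ in atTop, f (x + ((n : ℝ) + 1)⁻¹ • h) ≤ M := by
    intro h
    obtain ⟨s, hs, hsd⟩ : ∃ s : ℝ, 0 < s ∧ x + s • h ∈ effDom f := by
      refine ⟨R / 2 / (‖h‖ + 1), by positivity, hball ?_⟩
      rw [Metric.mem_ball, dist_eq_norm, add_sub_cancel_left, norm_smul, Real.norm_eq_abs,
        abs_of_pos (by positivity), div_mul_eq_mul_div, div_lt_iff₀ (by positivity)]
      nlinarith [norm_nonneg h]
    have hlim : Tendsto (fun n : ℕ => ((n : ℝ) + 1)⁻¹ / s) atTop (𝓝 0) := by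
      simpa using (tendsto_one_div_add_atTop_nhds_zero_nat (𝕜 := ℝ)).div_const s
    have hlim2 : Tendsto (fun n : ℕ => ((n : ℝ) + 1)⁻¹ / s *
        ((f (x + s • h)).toReal - (f x).toReal)) atTop (𝓝 0) := by
      simpa using hlim.mul_const ((f (x + s • h)).toReal - (f x).toReal)
    filter_upwards [hlim.eventually (gt_mem_nhds one_pos),
      hlim2.eventually (gt_mem_nhds one_pos)] with n h1 h2
    set t := ((n : ℝ) + 1)⁻¹ / s with ht
    have ht0 : 0 ≤ t := by positivity
    have := hf.comb_le (sub_nonneg.2 h1.le) ht0 (by ring) (hf.coe_toReal hxd).ge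
      (hf.coe_toReal hsd).ge
    have e : (1 - t) • x + t • (x + s • h) = x + ((n : ℝ) + 1)⁻¹ • h := by
      have : ((n : ℝ) + 1)⁻¹ = t * s := by rw [ht]; field_simp
      rw [this]
      module
    rw [e] at this
    refine this.trans (EReal.coe_le_coe_iff.2 ?_)
    rw [hM]
    linarith
  have hU : ⋃ n, K n = Set.univ := by
    refine Set.eq_univ_of_forall fun h => ?_
    obtain ⟨n, h1, h2⟩ := ((key h).and (key (-h))).exists
    refine Set.mem_iUnion.2 ⟨n, h1, ?_⟩
    simpa [sub_eq_add_neg] using h2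
  obtain ⟨n, y₀, hy₀⟩ := nonempty_interior_of_iUnion_of_closed hKc hU
  obtain ⟨ρ, hρ, hb⟩ := Metric.mem_nhds_iff.1 (mem_interior_iff_mem_nhds.1 hy₀)
  set c : ℝ := ((n : ℝ) + 1)⁻¹ with hc
  have hc0 : 0 < c := by positivity
  refine ⟨c * ρ, by positivity, M, fun y hy => ?_⟩
  set h : E := c⁻¹ • (y - x) with hh
  have hhρ : ‖h‖ < ρ := by
    rw [hh, norm_smul, norm_inv, Real.norm_eq_abs, abs_of_pos hc0, inv_mul_lt_iff₀ hc0]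
    simpa [dist_eq_norm] using hy
  have h1 : f (x + c • (y₀ + h)) ≤ M := (hb (by simpa [dist_eq_norm] using hhρ)).1
  have h2 : f (x - c • (y₀ - h)) ≤ M := (hb (by simpa [dist_eq_norm] using hhρ)).2
  -- The centre y₀ of that ball cancels: x + c h is the midpoint of x + c(y₀ + h) and x - c(y₀ - h).
  have := hf.comb_le (a := 1 / 2) (b := 1 / 2) (by norm_num) (by norm_num) (by norm_num) h1 h2
  have e : (1 / 2 : ℝ) • (x + c • (y₀ + h)) + (1 / 2 : ℝ) • (x - c • (y₀ - h)) = y := by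
    have : y = x + c • h := by rw [hh, smul_smul, mul_inv_cancel₀ hc0.ne', one_smul]; abel
    rw [this]
    module
  rw [e] at this
  convert this using 2
  ring

end Basics

/-! ### Separation of epigraphs: sum rule and affine minorants. -/

section HahnBanach

variable {E : Type*} [NormedAddCommGroup E] [NormedSpace ℝ E] {f g : E → EReal}

theorem IsGammaZero.convexOn_toReal (hf : IsGammaZero f) :
    ConvexOn ℝ (effDom f) fun x => (f x).toReal :=
  ⟨hf.convex_effDom, fun _ hx _ hy _ _ ha hb hab => hf.toReal_comb_le ha hb hab hx hy⟩

theorem dual_prod_apply (l : StrongDual ℝ (E × ℝ)) (y : E) (s : ℝ) :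
    l (y, s) = l.comp (ContinuousLinearMap.inl ℝ E ℝ) y + l (0, 1) * s := by
  have : (y, s) = (y, (0 : ℝ)) + s • ((0 : E), (1 : ℝ)) := by simp
  rw [this, map_add, map_smul, smul_eq_mul, mul_comm]
  rfl

theorem eq_zero_of_le_near (v : StrongDual ℝ E) {z : E} {s : Set E} (hs : s ∈ 𝓝 z)
    (h : ∀ y ∈ s, v y ≤ v z) : v = 0 := by
  have hmax : IsLocalMax v z := by filter_upwards [hs] with y hy using h y hy
  have h1 := hmax.fderiv_eq_zero
  rwa [ContinuousLinearMap.fderiv] at h1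

/-- Moreau–Rockafellar: at a minimizer of `f + g` there are opposite subgradients as soon as
`int dom f` meets the domain of the convex function `g`. -/
theorem IsGammaZero.exists_mem_subdiff_of_isMin [CompleteSpace E] (hf : IsGammaZero f)
    {C : Set E} {g : E → ℝ} (hg : ConvexOn ℝ C g) {x z : E} (hxf : x ∈ effDom f) (hxC : x ∈ C)
    (hz : z ∈ interior (effDom f)) (hzC : z ∈ C)
    (hmin : ∀ y ∈ effDom f, y ∈ C → (f x).toReal + g x ≤ (f y).toReal + g y) :
    ∃ u ∈ subdiff f x, ∀ y ∈ C, g x - u (y - x) ≤ g y := by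
  obtain ⟨r, hr, M, hM⟩ := hf.exists_ball_le hz
  -- The hypograph of the concave function (f + g)(x) - g. Minimality at x keeps it below the
  -- epigraph of f, and the two touch above x.
  let B : Set (E × ℝ) := {p | p.1 ∈ C ∧ p.2 ≤ (f x).toReal + g x - g p.1}
  have hB : Convex ℝ B := by
    rintro ⟨y, s⟩ ⟨hy, hs⟩ ⟨y', s'⟩ ⟨hy', hs'⟩ a b ha hb hab
    refine ⟨hg.1 hy hy' ha hb hab, ?_⟩
    have := hg.2 hy hy' ha hb hab
    simp only [smul_eq_mul, Prod.fst_add, Prod.smul_fst, Prod.snd_add, Prod.smul_snd] at *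
    have e : (f x).toReal + g x = a * ((f x).toReal + g x) + b * ((f x).toReal + g x) := by
      rw [← add_mul, hab, one_mul]
    nlinarith
  have hsub : Metric.ball z r ×ˢ Set.Ioi M ⊆ realEpi f := fun p hp =>
    (hM p.1 hp.1).trans (EReal.coe_le_coe_iff.2 hp.2.le)
  have hint : (interior (realEpi f)).Nonempty :=
    ⟨(z, M + 1), interior_maximal hsub (Metric.isOpen_ball.prod isOpen_Ioi)
      ⟨Metric.mem_ball_self hr, by simp⟩⟩
  have hdisj : Disjoint (interior (realEpi f)) B := by
    rw [Set.disjoint_left]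
    rintro ⟨y, s⟩ hys ⟨hyC, hs⟩
    have hcont : Tendsto (fun t : ℝ => (y, s - t)) (𝓝[>] 0) (𝓝 (y, s)) := by
      have : Continuous fun t : ℝ => (y, s - t) := by fun_prop
      simpa using (this.tendsto 0).mono_left nhdsWithin_le_nhds
    obtain ⟨t, ht, ht0⟩ := ((hcont.eventually (mem_interior_iff_mem_nhds.1 hys)).and
      self_mem_nhdsWithin).exists
    have hle : f y ≤ ((s - t : ℝ) : EReal) := ht
    have hyd := mem_effDom_of_le hle
    have h1 := (hf.le_coe_iff hyd).1 hle
    have h2 := hmin y hyd hyC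
    have : 0 < t := ht0
    simp only at hs
    linarith
  obtain ⟨l, c, hl0, hlA, hlB⟩ := geometric_hahn_banach_of_nonempty_interior hf.convex_realEpi hB
    hdisj hint ⟨(x, (f x).toReal), hxC, by simp⟩
  set v := l.comp (ContinuousLinearMap.inl ℝ E ℝ) with hv
  set α := l (0, 1) with hα
  have hA : ∀ y ∈ effDom f, ∀ s, (f y).toReal ≤ s → v y + α * s ≤ c := fun y hy s hs => by
    rw [← dual_prod_apply]
    exact hlA (y, s) ((hf.le_coe_iff hy).2 hs)
  have hB' : ∀ y ∈ C, c ≤ v y + α * ((f x).toReal + g x - g y) := fun y hy => by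
    rw [← dual_prod_apply]
    exact hlB _ ⟨hy, le_rfl⟩
  have hcx : v x + α * (f x).toReal = c := by
    refine le_antisymm (hA x hxf _ le_rfl) ?_
    have := hB' x hxC
    simpa using this
  have hα0 : α ≤ 0 := by
    have := hA x hxf ((f x).toReal + 1) (by linarith)
    linarith
  -- The qualification condition excludes a vertical hyperplane: with α = 0, v would attain its
  -- maximum over dom f at the interior point z, so v = 0.
  have hα1 : α ≠ 0 := by
    intro h0
    have hvz : v = 0 := by
      refine eq_zero_of_le_near v (mem_interior_iff_mem_nhds.1 hz) fun y hy => ?_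
      have h1 := hA y hy _ le_rfl
      have h2 := hB' z hzC
      rw [h0] at h1 h2
      linarith
    apply hl0
    ext1
    · ext y
      simpa [hv] using DFunLike.congr_fun hvz y
    · ext
      simpa using h0
  have hαn : α < 0 := lt_of_le_of_ne hα0 hα1
  have hdiv : ∀ y, ((-α)⁻¹ • v) y = v y / (-α) := fun y => by
    simp [div_eq_inv_mul]
  refine ⟨(-α)⁻¹ • v, (mem_subdiff_iff hf hxf).2 fun y hy => ?_, fun y hy => ?_⟩
  · have := hA y hy _ le_rfl
    rw [hdiv, map_sub, ← le_sub_iff_add_le, div_le_iff₀ (by linarith)]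
    nlinarith
  · have := hB' y hy
    rw [hdiv, map_sub, sub_le_iff_le_add, ← sub_le_iff_le_add', le_div_iff₀ (by linarith)]
    nlinarith

/-- Points strictly below the graph are strictly below an affine minorant, up to a vertical
separation. -/
theorem IsGammaZero.exists_separation (hf : IsGammaZero f) {x : E} {r : ℝ} (hr : (r : EReal) < f x) :
    ∃ (v : StrongDual ℝ E) (α c : ℝ), 0 ≤ α ∧ c < v x - α * r ∧
      ∀ y ∈ effDom f, v y - α * (f y).toReal < c := by
  obtain ⟨l, c, hl, hc⟩ := geometric_hahn_banach_closed_point hf.convex_realEpi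
    hf.isClosed_realEpi (x := (x, r)) (by simpa [realEpi] using hr)
  set v := l.comp (ContinuousLinearMap.inl ℝ E ℝ) with hv
  have hA : ∀ y ∈ effDom f, ∀ s, (f y).toReal ≤ s → v y + l (0, 1) * s < c := fun y hy s hs => by
    rw [← dual_prod_apply]
    exact hl (y, s) ((hf.le_coe_iff hy).2 hs)
  refine ⟨v, -l (0, 1), c, ?_, ?_, fun y hy => ?_⟩
  · obtain ⟨y, hy⟩ := hf.dom_nonempty
    by_contra hneg
    push Not at hneg
    set α := l (0, 1)
    have hα : 0 < α := by linarith
    have := hA y hy ((f y).toReal + |c - v y - α * (f y).toReal| / α) (by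
      have : 0 ≤ |c - v y - α * (f y).toReal| / α := by positivity
      linarith)
    rw [mul_add, mul_div_cancel₀ _ hα.ne'] at this
    linarith [le_abs_self (c - v y - α * (f y).toReal)]
  · rw [dual_prod_apply] at hc
    linarith
  · have := hA y hy _ le_rfl
    linarith

/-- Separating a point strictly below the graph above a domain point cannot produce a vertical
hyperplane. -/
theorem IsGammaZero.exists_affine_minorant (hf : IsGammaZero f) :
    ∃ (u : StrongDual ℝ E) (c : ℝ), ∀ y ∈ effDom f, u y - c ≤ (f y).toReal := by
  obtain ⟨x, hx⟩ := hf.dom_nonempty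
  obtain ⟨v, α, c, hα, hc, h⟩ := hf.exists_separation (x := x) (r := (f x).toReal - 1) (by
    conv_rhs => rw [← hf.coe_toReal hx]
    exact EReal.coe_lt_coe_iff.2 (by linarith))
  have hx' := h x hx
  have hα' : 0 < α := by
    by_contra hn
    have : α = 0 := le_antisymm (not_lt.1 hn) hα
    rw [this] at hc hx'
    linarith
  refine ⟨α⁻¹ • v, c / α, fun y hy => ?_⟩
  have := h y hy
  have e : (α⁻¹ • v) y = v y / α := by simp [div_eq_inv_mul]
  rw [e, ← sub_div, div_le_iff₀ hα']
  linarith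

/-- Fenchel–Moreau: `f` is the supremum of its affine minorants. -/
theorem IsGammaZero.exists_affine_between (hf : IsGammaZero f) {x : E} {r : ℝ}
    (hr : (r : EReal) < f x) :
    ∃ (u : StrongDual ℝ E) (c : ℝ), r < u x - c ∧ ∀ y ∈ effDom f, u y - c ≤ (f y).toReal := by
  obtain ⟨v, α, c, hα, hc, h⟩ := hf.exists_separation hr
  rcases hα.eq_or_lt with h0 | hα
  · obtain ⟨w, d, hw⟩ := hf.exists_affine_minorant
    rw [← h0] at hc h
    simp only [zero_mul, sub_zero] at hc h
    -- Vertical case: v - c is negative on dom f and positive at x, so adding a large multiple of it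
    -- to any affine minorant keeps a minorant and lifts it above r at x.
    set t := (|r - (w x - d)| + 1) / (v x - c) with ht
    have ht0 : 0 ≤ t := div_nonneg (by positivity) (by linarith)
    have e : t * (v x - c) = |r - (w x - d)| + 1 := by
      rw [ht, div_mul_cancel₀]
      linarith
    refine ⟨w + t • v, d + t * c, ?_, fun y hy => ?_⟩
    · have := le_abs_self (r - (w x - d))
      simp only [add_apply, smul_apply, smul_eq_mul]
      linarith
    · have h1 := hw y hy
      have h2 := mul_le_mul_of_nonneg_left (h y hy).le ht0
      simp only [add_apply, smul_apply, smul_eq_mul]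
      linarith
  · have e : ∀ y, (α⁻¹ • v) y = v y / α := fun y => by simp [div_eq_inv_mul]
    refine ⟨α⁻¹ • v, c / α, ?_, fun y hy => ?_⟩
    · rw [e, ← sub_div, lt_div_iff₀ hα]
      linarith
    · have := h y hy
      rw [e, ← sub_div, div_le_iff₀ hα]
      linarith

end HahnBanach

/-! ### Fenchel conjugates. -/

section Conjugate

variable {E : Type*} [NormedAddCommGroup E] [NormedSpace ℝ E] {f : E → EReal}

theorem conj_le_coe_iff (hf : IsGammaZero f) {u : StrongDual ℝ E} {c : ℝ} :
    conj f u ≤ c ↔ ∀ y ∈ effDom f, u y - (f y).toReal ≤ c := by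
  rw [conj, iSup_le_iff]
  constructor
  · intro h y hy
    have := h y
    rw [← hf.coe_toReal hy] at this
    exact_mod_cast this
  · intro h y
    by_cases hy : y ∈ effDom f
    · rw [← hf.coe_toReal hy]
      exact_mod_cast h y hy
    · have : f y = ⊤ := by simpa [effDom] using hy
      simp [this]

theorem isGammaZero_conj (hf : IsGammaZero f) : IsGammaZero (conj f) := by
  refine .of_comb_le (fun u hu => ?_) ?_ ?_ ?_
  · obtain ⟨y, hy⟩ := hf.dom_nonempty
    have : ((u y : ℝ) : EReal) - f y ≤ ⊥ := hu ▸ le_iSup (fun x : E => ((u x : ℝ) : EReal) - f x) y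
    rw [← hf.coe_toReal hy, ← EReal.coe_sub] at this
    exact EReal.coe_ne_bot _ (le_bot_iff.1 this)
  · obtain ⟨u, c, h⟩ := hf.exists_affine_minorant
    exact ⟨u, mem_effDom_of_le ((conj_le_coe_iff hf).2 fun y hy => by linarith [h y hy])⟩
  · refine lowerSemicontinuous_iSup fun y => ?_
    by_cases hy : y ∈ effDom f
    · have : Continuous fun u : StrongDual ℝ E => ((u y : ℝ) : EReal) - f y := by
        rw [← hf.coe_toReal hy]
        simp only [← EReal.coe_sub]
        exact continuous_coe_real_ereal.comp (by fun_prop)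
      exact this.lowerSemicontinuous
    · have : f y = ⊤ := by simpa [effDom] using hy
      simpa [this] using lowerSemicontinuous_const
  · intro u w r s a b ha hb hab hu hw
    rw [conj_le_coe_iff hf] at *
    intro y hy
    have h1 := mul_le_mul_of_nonneg_left (hu y hy) ha.le
    have h2 := mul_le_mul_of_nonneg_left (hw y hy) hb.le
    have e : (f y).toReal = a * (f y).toReal + b * (f y).toReal := by rw [← add_mul, hab, one_mul]
    simp only [add_apply, smul_apply, smul_eq_mul]
    linarith

theorem young (hf : IsGammaZero f) {x : E} {u : StrongDual ℝ E} (hx : x ∈ effDom f)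
    (hu : u ∈ effDom (conj f)) : u x ≤ (f x).toReal + (conj f u).toReal := by
  have := (conj_le_coe_iff hf).1 ((isGammaZero_conj hf).coe_toReal hu).ge x hx
  linarith

theorem mem_subdiff_iff_conj (hf : IsGammaZero f) {x : E} {u : StrongDual ℝ E}
    (hx : x ∈ effDom f) : u ∈ subdiff f x ↔ conj f u ≤ ((u x - (f x).toReal : ℝ) : EReal) := by
  rw [mem_subdiff_iff hf hx, conj_le_coe_iff hf]
  refine forall₂_congr fun y _ => ?_
  rw [map_sub]
  constructor <;> intro h <;> linarith

/-- Biconjugation without f**: if f(x) exceeded u(x) - f*(u), an affine minorant w - c of f would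
exceed it at x too, and f*(w) ≤ c would violate the subgradient inequality of f* at u. -/
theorem mem_subdiff_of_inclusion_mem (hf : IsGammaZero f) {x : E} {u : StrongDual ℝ E}
    (hu : NormedSpace.inclusionInDoubleDual ℝ E x ∈ subdiff (conj f) u) : u ∈ subdiff f x := by
  have hf' := isGammaZero_conj hf
  have hud := hf'.mem_effDom_of_mem_subdiff hu
  have key : f x ≤ ((u x - (conj f u).toReal : ℝ) : EReal) := by
    by_contra hlt
    obtain ⟨w, c, h1, h2⟩ := hf.exists_affine_between (not_le.1 hlt)
    have hw : conj f w ≤ c := (conj_le_coe_iff hf).2 fun y hy => by linarith [h2 y hy]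
    have h3 := hf'.subdiff_le hu (mem_effDom_of_le hw)
    have h4 := (hf'.le_coe_iff (mem_effDom_of_le hw)).1 hw
    simp only [NormedSpace.dual_def, sub_apply] at h3
    linarith
  have hx := mem_effDom_of_le key
  rw [mem_subdiff_iff_conj hf hx, hf'.le_coe_iff hud]
  have := (hf.le_coe_iff hx).1 key
  linarith

/-- If `f` is bounded above near `z`, then `f* - z` is coercive. -/
theorem norm_le_of_ball_le (hf : IsGammaZero f) {z : E} {r M : ℝ} (hr : 0 < r)
    (hM : ∀ y ∈ Metric.ball z r, f y ≤ M) {u : StrongDual ℝ E} (hu : u ∈ effDom (conj f)) :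
    r / 2 * ‖u‖ ≤ (conj f u).toReal - u z + M := by
  have key : ∀ d : E, ‖d‖ < r → u d ≤ (conj f u).toReal - u z + M := fun d hd => by
    have hm : z + d ∈ Metric.ball z r := by simpa [dist_eq_norm] using hd
    have h1 := hM _ hm
    have h2 := young hf (mem_effDom_of_le h1) hu
    have h3 := (hf.le_coe_iff (mem_effDom_of_le h1)).1 h1
    rw [map_add] at h2
    linarith
  set A := (conj f u).toReal - u z + M with hA
  have hA0 : 0 ≤ A := by simpa using key 0 (by simpa using hr)
  have : ‖u‖ ≤ A / (r / 2) := by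
    refine ContinuousLinearMap.opNorm_le_bound _ (by positivity) fun d => ?_
    rcases eq_or_ne d 0 with rfl | hd
    · simp
    have hdn : 0 < ‖d‖ := norm_pos_iff.2 hd
    have hn : ‖(r / 2 / ‖d‖) • d‖ < r := by
      rw [norm_smul, Real.norm_eq_abs, abs_of_pos (by positivity), div_mul_cancel₀ _ hdn.ne']
      linarith
    have h1 := key _ hn
    have h2 := key (-((r / 2 / ‖d‖) • d)) (by rwa [norm_neg])
    rw [map_neg] at h2
    rw [map_smul, smul_eq_mul] at h1 h2
    have h3 : |r / 2 / ‖d‖ * u d| ≤ A := abs_le.2 ⟨by linarith, h1⟩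
    rw [abs_mul, abs_of_pos (by positivity : 0 < r / 2 / ‖d‖)] at h3
    rw [Real.norm_eq_abs]
    field_simp at h3 ⊢
    exact h3
  rw [le_div_iff₀ (by positivity)] at this
  linarith

end Conjugate

/-! ### Gâteaux gradients and uniqueness of subgradients. -/

section Gradient

variable {E : Type*} [NormedAddCommGroup E] [NormedSpace ℝ E] {f : E → EReal}

theorem hasGateauxGradAt_grad {x : E} (h : GateauxDiffAt f x) : HasGateauxGradAt f (grad f x) x := by
  rw [grad, dif_pos h]
  exact h.choose_spec

theorem IsGammaZero.mem_subdiff_of_hasGateauxGradAt (hf : IsGammaZero f) {x : E}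
    {u : StrongDual ℝ E} (hu : HasGateauxGradAt f u x) : u ∈ subdiff f x := by
  have hx := interior_subset hu.1
  refine (mem_subdiff_iff hf hx).2 fun y hy => ?_
  have hlim := (hu.2 (y - x)).tendsto_slope_zero_right
  refine le_sub_iff_add_le.1 (le_of_tendsto hlim ?_)
  filter_upwards [Ioo_mem_nhdsGT (zero_lt_one' ℝ)] with t ht
  have := hf.toReal_comb_le (sub_nonneg.2 ht.2.le) ht.1.le (by ring) hx hy
  have e : (1 - t) • x + t • y = x + t • (y - x) := by module
  rw [e] at this
  rw [smul_eq_mul, inv_mul_le_iff₀ ht.1]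
  linarith

theorem IsGammaZero.eq_of_mem_subdiff (hf : IsGammaZero f) {x : E} {u w : StrongDual ℝ E}
    (hu : HasGateauxGradAt f u x) (hw : w ∈ subdiff f x) : w = u := by
  have hle : ∀ h, w h ≤ u h := fun h => by
    refine ge_of_tendsto (hu.2 h).tendsto_slope_zero_right ?_
    have hc : Tendsto (fun t : ℝ => x + t • h) (𝓝[>] 0) (𝓝 x) := by
      have : Continuous fun t : ℝ => x + t • h := by fun_prop
      simpa using (this.tendsto 0).mono_left nhdsWithin_le_nhds
    filter_upwards [hc.eventually (mem_interior_iff_mem_nhds.1 hu.1), self_mem_nhdsWithin]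
      with t ht ht0
    have h1 := hf.subdiff_le hw ht
    rw [add_sub_cancel_left, map_smul, smul_eq_mul] at h1
    rw [smul_eq_mul, le_inv_mul_iff₀ ht0]
    linarith
  ext h
  refine le_antisymm (hle h) ?_
  have := hle (-h)
  simp only [map_neg] at this
  linarith

theorem IsGammaZero.eq_grad_of_mem_subdiff (hf : IsGammaZero f) {x : E} {w : StrongDual ℝ E}
    (h : GateauxDiffAt f x) (hw : w ∈ subdiff f x) : w = grad f x :=
  hf.eq_of_mem_subdiff (hasGateauxGradAt_grad h) hw

theorem IsGammaZero.grad_mem_subdiff (hf : IsGammaZero f) {x : E} (h : GateauxDiffAt f x) :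
    grad f x ∈ subdiff f x :=
  hf.mem_subdiff_of_hasGateauxGradAt (hasGateauxGradAt_grad h)

/-- A convex function of one variable with a unique subgradient is differentiable. -/
theorem hasDerivAt_of_unique_subgradient {S : Set ℝ} {F : ℝ → ℝ} (hF : ConvexOn ℝ S F) {x m : ℝ}
    (hx : x ∈ interior S)
    (h : ∀ d, (∀ y ∈ S, F x + d * (y - x) ≤ F y) → d = m) : HasDerivAt F m x := by
  have hlr := hF.leftDeriv_le_rightDeriv_of_mem_interior hx
  have hsub : ∀ d, derivWithin F (Set.Iio x) x ≤ d → d ≤ derivWithin F (Set.Ioi x) x →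
      d = m := fun d hd1 hd2 => by
    refine h d fun y hy => ?_
    rcases lt_trichotomy y x with hyx | rfl | hyx
    · have := (hF.slope_le_leftDeriv_of_mem_interior hy hx hyx).trans hd1
      rw [slope_def_field, div_le_iff₀ (by linarith)] at this
      linarith
    · simp
    · have := hd2.trans (hF.rightDeriv_le_slope_of_mem_interior hx hy hyx)
      rw [slope_def_field, le_div_iff₀ (by linarith)] at this
      linarith
  have hl := hF.hasDerivWithinAt_leftDeriv_of_mem_interior hx
  have hr := hF.hasDerivWithinAt_rightDeriv_of_mem_interior hx
  rw [hsub _ le_rfl hlr] at hl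
  rw [hsub _ hlr le_rfl] at hr
  rw [hasDerivAt_iff_tendsto_slope, ← Set.Iio_union_Ioi, nhdsWithin_union, tendsto_sup]
  rw [hasDerivWithinAt_iff_tendsto_slope' (by simp)] at hl hr
  exact ⟨hl, hr⟩

/-- On each line through x, a supporting slope d of the restriction extends to a subgradient of f,
which must be u; hence d = u(h) and the restriction is differentiable. -/
theorem IsGammaZero.gateauxDiffAt_of_subsingleton [CompleteSpace E] (hf : IsGammaZero f) {x : E}
    (hx : x ∈ interior (effDom f)) {u : StrongDual ℝ E} (hu : ∀ w ∈ subdiff f x, w = u) :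
    HasGateauxGradAt f u x := by
  refine ⟨hx, fun h => ?_⟩
  rcases eq_or_ne h 0 with rfl | hh
  · simp [HasLineDerivAt, hasDerivAt_const]
  let A : ℝ →ᵃ[ℝ] E := AffineMap.lineMap x (x + h)
  have hA : ∀ t, A t = x + t • h := fun t => by simp [A, AffineMap.lineMap_apply, add_comm]
  have hAc : Continuous A := by
    have : (A : ℝ → E) = fun t => x + t • h := funext hA
    rw [this]
    fun_prop
  have hconv := hf.convexOn_toReal.comp_affineMap A
  have h0 : (0 : ℝ) ∈ interior (A ⁻¹' effDom f) := by
    refine preimage_interior_subset_interior_preimage hAc ?_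
    simpa [hA] using hx
  have hfun : (fun t => (f (x + t • h)).toReal) = (fun x => (f x).toReal) ∘ A := by
    ext t
    simp [hA]
  rw [HasLineDerivAt, hfun]
  refine hasDerivAt_of_unique_subgradient hconv h0 fun d hd => ?_
  obtain ⟨l, hl⟩ := SeparatingDual.exists_eq_one (R := ℝ) hh
  let C : Set E := Set.range fun t : ℝ => x + t • h
  have hC : Convex ℝ C := by
    rintro _ ⟨s, rfl⟩ _ ⟨t, rfl⟩ a b ha hb hab
    refine ⟨a * s + b * t, ?_⟩
    obtain rfl : b = 1 - a := by linarith
    dsimp only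
    module
  have hxC : x ∈ C := ⟨0, by simp⟩
  -- Since l(h) = 1, d l has slope d along the line, and x minimizes f - d l there. The sum rule
  -- performs the extension; testing at x + h and x - h gives w(h) = d.
  obtain ⟨w, hw, hwC⟩ := hf.exists_mem_subdiff_of_isMin (C := C) (g := fun y => (-d) * l y)
    (x := x) (z := x) ⟨hC, fun y _ z _ a b _ _ _ => by simp; linarith⟩
    (interior_subset hx) hxC hx hxC (by
      rintro _ hy ⟨t, rfl⟩
      have := hd t (by simpa [hA] using hy)
      simp only [Function.comp_apply, hA, zero_smul, add_zero, sub_zero] at this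
      simp only [map_add, map_smul, hl, smul_eq_mul]
      linarith)
  have h1 := hwC (x + (1 : ℝ) • h) ⟨1, rfl⟩
  have h2 := hwC (x + (-1 : ℝ) • h) ⟨-1, rfl⟩
  simp only [add_sub_cancel_left, map_add, map_smul, hl, smul_eq_mul] at h1 h2
  rw [← hu w hw]
  linarith

end Gradient

/-! ### Legendre functions and the inversion of their gradients. -/

section Legendre

variable {E : Type*} [NormedAddCommGroup E] [NormedSpace ℝ E] {f : E → EReal}

/-- At a boundary point, adding a nonzero normal v of dom f to a subgradient gives a second
subgradient. -/
theorem IsLegendre.mem_interior_of_mem_subdiff (hL : IsLegendre f) (hf : IsGammaZero f) {x : E}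
    {u : StrongDual ℝ E} (hu : u ∈ subdiff f x) : x ∈ interior (effDom f) := by
  by_contra hx
  obtain ⟨v, hv0, hv⟩ := geometric_hahn_banach_of_nonempty_interior_point hf.convex_effDom hx
    hL.interior_nonempty
  have hxd := hf.mem_effDom_of_mem_subdiff hu
  have huv : u + v ∈ subdiff f x := (mem_subdiff_iff hf hxd).2 fun y hy => by
    have h1 := hf.subdiff_le hu hy
    have h2 := hv y hy
    simp only [add_apply, map_sub] at h1 ⊢
    linarith
  exact hv0 (by simpa using hL.subdiff_single x ⟨u, hu⟩ huv hu)

theorem IsLegendre.grad_mem (hL : IsLegendre f) (hf : IsGammaZero f) {x : E}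
    (hx : x ∈ interior (effDom f)) : grad f x ∈ subdiff f x :=
  hf.grad_mem_subdiff (hL.gateaux x hx)

theorem IsLegendre.eq_grad (hL : IsLegendre f) (hf : IsGammaZero f) {x : E}
    {u : StrongDual ℝ E} (hu : u ∈ subdiff f x) : u = grad f x :=
  hf.eq_grad_of_mem_subdiff (hL.gateaux x (hL.mem_interior_of_mem_subdiff hf hu)) hu

/-- Supplies the convex subset of dom ∂f on which strict convexity is invoked: f is affine on such a
fiber. -/
theorem convex_subdiff_fiber (hf : IsGammaZero f) (u : StrongDual ℝ E) :
    Convex ℝ {x | u ∈ subdiff f x} := by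
  intro x hx y hy a b ha hb hab
  have hxd := hf.mem_effDom_of_mem_subdiff hx
  have hyd := hf.mem_effDom_of_mem_subdiff hy
  refine (mem_subdiff_iff hf (hf.comb_mem ha hb hab hxd hyd)).2 fun z hz => ?_
  have h1 := mul_le_mul_of_nonneg_left (hf.subdiff_le hx hz) ha
  have h2 := mul_le_mul_of_nonneg_left (hf.subdiff_le hy hz) hb
  have h3 := hf.toReal_comb_le ha hb hab hxd hyd
  simp only [map_sub, map_add, map_smul, smul_eq_mul] at h1 h2 ⊢
  obtain rfl : b = 1 - a := by linarith
  nlinarith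

/-- Essential strict convexity makes `∂f` injective. -/
theorem IsLegendre.eq_of_mem_subdiff (hL : IsLegendre f) (hf : IsGammaZero f) {x y : E}
    {u : StrongDual ℝ E} (hx : u ∈ subdiff f x) (hy : u ∈ subdiff f y) : x = y := by
  by_contra hne
  have hlt := hL.strictConvex _ (convex_subdiff_fiber hf u) (fun z hz => ⟨u, hz⟩) x hx y hy hne
    (1 / 2) (1 / 2) (by norm_num) (by norm_num) (by norm_num)
  have hxd := hf.mem_effDom_of_mem_subdiff hx
  have hyd := hf.mem_effDom_of_mem_subdiff hy
  have hm := hf.comb_mem (a := 1 / 2) (b := 1 / 2) (by norm_num) (by norm_num) (by norm_num) hxd hyd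
  rw [← hf.coe_toReal hxd, ← hf.coe_toReal hyd, ← hf.coe_toReal hm] at hlt
  have hlt' : (f ((1 / 2 : ℝ) • x + (1 / 2 : ℝ) • y)).toReal <
      1 / 2 * (f x).toReal + 1 / 2 * (f y).toReal := by exact_mod_cast hlt
  have h1 := hf.subdiff_le hx hm
  have h2 := hf.subdiff_le hy hm
  simp only [map_sub, map_add, map_smul, smul_eq_mul] at h1 h2
  linarith

theorem IsLegendre.grad_mem_effDom_conj (hL : IsLegendre f) (hf : IsGammaZero f) {x : E}
    (hx : x ∈ interior (effDom f)) : grad f x ∈ effDom (conj f) :=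
  mem_effDom_of_le ((mem_subdiff_iff_conj hf (interior_subset hx)).1 (hL.grad_mem hf hx))

theorem IsLegendre.conj_subdiff_eq (hE : IsReflexiveSpace E) (hL : IsLegendre f)
    (hf : IsGammaZero f) {x : E} {u : StrongDual ℝ E} (hu : u ∈ subdiff f x)
    {w : StrongDual ℝ (StrongDual ℝ E)} (hw : w ∈ subdiff (conj f) u) :
    w = NormedSpace.inclusionInDoubleDual ℝ E x := by
  obtain ⟨y, rfl⟩ := hE w
  rw [hL.eq_of_mem_subdiff hf (mem_subdiff_of_inclusion_mem hf hw) hu]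

/-- `∇f*` inverts `∇f`. -/
theorem IsLegendre.grad_conj_grad (hE : IsReflexiveSpace E) (hL : IsLegendre f)
    (hf : IsGammaZero f) {x : E} (hx : x ∈ interior (effDom f))
    (hu : grad f x ∈ interior (effDom (conj f))) :
    grad (conj f) (grad f x) = NormedSpace.inclusionInDoubleDual ℝ E x := by
  have hf' := isGammaZero_conj hf
  have hd := hf'.gateauxDiffAt_of_subsingleton hu fun w hw =>
    hL.conj_subdiff_eq hE hf (hL.grad_mem hf hx) hw
  exact hf'.eq_of_mem_subdiff hd (hf'.grad_mem_subdiff ⟨_, hd⟩)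

/-- The sum rule with C = {u} produces a subgradient of f* at the interior point u; reflexivity
represents it by a point of E. -/
theorem IsLegendre.exists_mem_subdiff_of_conj (hE : IsReflexiveSpace E) (hL : IsLegendre f)
    (hf : IsGammaZero f) {u : StrongDual ℝ E} (hu : u ∈ interior (effDom (conj f))) :
    ∃ x, u ∈ subdiff f x ∧ grad (conj f) u = NormedSpace.inclusionInDoubleDual ℝ E x := by
  have hf' := isGammaZero_conj hf
  obtain ⟨w, hw, -⟩ := hf'.exists_mem_subdiff_of_isMin (C := {u}) (g := fun _ => 0) (x := u)
    (z := u) (convexOn_const 0 (convex_singleton u)) (interior_subset hu) rfl hu rfl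
    (by rintro y _ rfl; exact le_rfl)
  obtain ⟨x, rfl⟩ := hE w
  have hx := mem_subdiff_of_inclusion_mem hf hw
  have hd := hf'.gateauxDiffAt_of_subsingleton hu fun w hw => hL.conj_subdiff_eq hE hf hx hw
  exact ⟨x, hx, hf'.eq_of_mem_subdiff hd (hf'.grad_mem_subdiff ⟨_, hd⟩)⟩

end Legendre

/-! ### Weak convergence and weak sequential compactness. -/

section Weak

variable {E F : Type*} [NormedAddCommGroup E] [NormedSpace ℝ E] [NormedAddCommGroup F]
  [NormedSpace ℝ F]

theorem tendsto_toWeakSpace_iff {α : Type*} {l : Filter α} {u : α → E} {x : E} :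
    Tendsto (fun n => toWeakSpace ℝ E (u n)) l (𝓝 (toWeakSpace ℝ E x)) ↔
      ∀ w : StrongDual ℝ E, Tendsto (fun n => w (u n)) l (𝓝 (w x)) := by
  refine WeakBilin.tendsto_iff_forall_eval_tendsto (topDualPairing ℝ E).flip ?_
  intro x y hxy
  by_contra hne
  obtain ⟨w, hw⟩ := SeparatingDual.exists_separating_of_ne (R := ℝ) hne
  exact hw (LinearMap.congr_fun hxy w)

theorem weakTendsto_iff {u : ℕ → E} {x : E} :
    WeakTendsto u x ↔ ∀ w : StrongDual ℝ E, Tendsto (fun n => w (u n)) atTop (𝓝 (w x)) :=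
  tendsto_toWeakSpace_iff

theorem WeakTendsto.unique {u : ℕ → E} {x y : E} (hx : WeakTendsto u x) (hy : WeakTendsto u y) :
    x = y := by
  by_contra hne
  obtain ⟨w, hw⟩ := SeparatingDual.exists_separating_of_ne (R := ℝ) hne
  exact hw (tendsto_nhds_unique (weakTendsto_iff.1 hx w) (weakTendsto_iff.1 hy w))

theorem WeakTendsto.comp {u : ℕ → E} {x : E} (hx : WeakTendsto u x) {k : ℕ → ℕ}
    (hk : Tendsto k atTop atTop) : WeakTendsto (fun n => u (k n)) x :=
  Tendsto.comp (g := fun n => toWeakSpace ℝ E (u n)) hx hk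

theorem WeakTendsto.map {u : ℕ → E} {x : E} (hx : WeakTendsto u x) (A : E →L[ℝ] F) :
    WeakTendsto (fun n => A (u n)) (A x) :=
  weakTendsto_iff.2 fun w => weakTendsto_iff.1 hx (w.comp A)

theorem WeakTendsto.sum {ι : Type*} {s : Finset ι} {u : ι → ℕ → E} {x : ι → E}
    (h : ∀ i ∈ s, WeakTendsto (u i) (x i)) :
    WeakTendsto (fun n => ∑ i ∈ s, u i n) (∑ i ∈ s, x i) :=
  weakTendsto_iff.2 fun w => by
    simp only [map_sum]
    exact tendsto_finsetSum _ fun i hi => weakTendsto_iff.1 (h i hi) w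

/-- Weak sequential lower semicontinuity. -/
theorem IsGammaZero.eventually_lt {f : E → EReal} (hf : IsGammaZero f) {u : ℕ → E} {x : E}
    (hx : WeakTendsto u x) {r : EReal} (hr : r < f x) : ∀ᶠ n in atTop, r < f (u n) := by
  obtain ⟨s, hrs, hs⟩ := EReal.lt_iff_exists_real_btwn.1 hr
  obtain ⟨w, c, h1, h2⟩ := hf.exists_affine_between hs
  have := ((weakTendsto_iff.1 hx w).sub_const c).eventually (lt_mem_nhds h1)
  filter_upwards [this] with n hn
  refine hrs.trans ?_
  by_cases hd : u n ∈ effDom f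
  · rw [← hf.coe_toReal hd]
    exact EReal.coe_lt_coe_iff.2 (hn.trans_le (h2 _ hd))
  · have : f (u n) = ⊤ := by simpa [effDom] using hd
    simp [this]

theorem mem_of_weakTendsto {C : Set E} (hC : Convex ℝ C) (hcl : IsClosed C) {u : ℕ → E} {x : E}
    (hx : WeakTendsto u x) (hu : ∀ n, u n ∈ C) : x ∈ C := by
  by_contra h
  obtain ⟨w, c, h1, h2⟩ := geometric_hahn_banach_closed_point hC hcl h
  exact absurd (le_of_tendsto (weakTendsto_iff.1 hx w) (Eventually.of_forall fun n =>
    (h1 _ (hu n)).le)) h2.not_ge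

theorem isReflexiveSpace_dual (hE : IsReflexiveSpace E) : IsReflexiveSpace (StrongDual ℝ E) := by
  intro Φ
  refine ⟨Φ.comp (NormedSpace.inclusionInDoubleDual ℝ E), ?_⟩
  ext w
  obtain ⟨x, rfl⟩ := hE w
  simp

theorem isCompact_weak_closedBall (hE : IsReflexiveSpace E) (R : ℝ) :
    IsCompact (closure (toWeakSpace ℝ E '' Metric.closedBall 0 R)) := by
  refine NormedSpace.isCompact_closure_of_isBounded ℝ E _ ?_ ?_
  · rw [Set.preimage_image_eq _ (toWeakSpace ℝ E).injective]
    exact Metric.isBounded_closedBall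
  · intro w _
    obtain ⟨x, hx⟩ := hE (WeakDual.toStrongDual w)
    exact ⟨toWeakSpace ℝ E x, hx⟩

/-- Bounded sequences of a reflexive space have weakly convergent subsequences. -/
theorem exists_weakTendsto_subseq (hE : IsReflexiveSpace E) {u : ℕ → E} {R : ℝ}
    (hu : ∀ n, ‖u n‖ ≤ R) : ∃ (x : E) (k : ℕ → ℕ), StrictMono k ∧ WeakTendsto (u ∘ k) x := by
  -- Everything takes place in the separable closed span M of the sequence. Norming functionals of a
  -- countable set approximating M give countably many coordinates; a subsequence converges in all
  -- of them, and weak compactness upgrades this once the cluster point is unique.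
  let M : Submodule ℝ E := (Submodule.span ℝ (Set.range u)).topologicalClosure
  have hMsep : TopologicalSpace.IsSeparable (M : Set E) :=
    ((Set.countable_range u).isSeparable.span (R := ℝ)).closure
  obtain ⟨c, hc, hcM⟩ := hMsep
  have huM : ∀ n, u n ∈ M := fun n =>
    Submodule.le_topologicalClosure _ (Submodule.subset_span ⟨n, rfl⟩)
  choose l hl1 hl2 using fun y : E => exists_dual_vector'' ℝ y
  have : Countable c := hc
  let K : Set (c → ℝ) := Set.univ.pi fun _ => Set.Icc (-R) R
  have hK : IsCompact K := isCompact_univ_pi fun _ => isCompact_Icc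
  obtain ⟨a, -, k, hk, hka⟩ := hK.tendsto_subseq (x := fun n (y : c) => l y (u n)) fun n y _ => by
    have : ‖l y (u n)‖ ≤ R := ((l y).le_of_opNorm_le (hl1 y) _).trans (by simpa using hu n)
    rwa [Real.norm_eq_abs, abs_le] at this
  have hcoord : ∀ y : c, Tendsto (fun n => l y (u (k n))) atTop (𝓝 (a y)) := fun y =>
    (tendsto_pi_nhds.1 hka) y
  have hcpt := isCompact_weak_closedBall hE R
  have hmem : ∀ᶠ n in atTop, toWeakSpace ℝ E (u (k n)) ∈
      closure (toWeakSpace ℝ E '' Metric.closedBall 0 R) :=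
    Eventually.of_forall fun n => subset_closure ⟨_, by simpa using hu (k n), rfl⟩
  have hcl : ∀ z : E, MapClusterPt (toWeakSpace ℝ E z) atTop (fun n => toWeakSpace ℝ E (u (k n))) →
      z ∈ M ∧ ∀ y : c, l y z = a y := by
    intro z hz
    obtain ⟨U, hU, hUz⟩ := mapClusterPt_iff_ultrafilter.1 hz
    rw [tendsto_toWeakSpace_iff] at hUz
    refine ⟨?_, fun y => tendsto_nhds_unique (hUz (l y)) ((hcoord y).mono_left hU)⟩
    by_contra hzM
    obtain ⟨w, d, h1, h2⟩ := geometric_hahn_banach_closed_point M.convex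
      (Submodule.isClosed_topologicalClosure _) hzM
    exact absurd (le_of_tendsto (hUz w) (Eventually.of_forall fun n => (h1 _ (huM (k n))).le))
      h2.not_ge
  obtain ⟨x, -, hx⟩ := hcpt.exists_mapClusterPt_of_frequently hmem.frequently
  obtain ⟨x, rfl⟩ := (toWeakSpace ℝ E).surjective x
  refine ⟨x, k, hk, hcpt.tendsto_nhds_of_unique_mapClusterPt hmem fun z _ hz => ?_⟩
  obtain ⟨z, rfl⟩ := (toWeakSpace ℝ E).surjective z
  congr 1
  have hxM := hcl x hx
  have hzM := hcl z hz
  rw [← sub_eq_zero, ← norm_le_zero_iff]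
  refine le_of_forall_pos_le_add fun ε hε => ?_
  -- The functional `l y` norms y and vanishes on z - x, so y close to z - x must itself be small.
  obtain ⟨y, hy, hyd⟩ := Metric.mem_closure_iff.1 (hcM (M.sub_mem hzM.1 hxM.1)) (ε / 2) (half_pos hε)
  rw [dist_eq_norm] at hyd
  have h1 : ‖y‖ ≤ ε / 2 := by
    have h2 : l y y = l y (y - (z - x)) := by
      rw [map_sub, map_sub, hzM.2 ⟨y, hy⟩, hxM.2 ⟨y, hy⟩, sub_self, sub_zero]
    have h3 := (l y).le_of_opNorm_le (hl1 y) (y - (z - x))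
    rw [← h2, hl2 y, norm_sub_rev, one_mul] at h3
    exact (by simpa using h3 : ‖y‖ ≤ ‖z - x - y‖).trans hyd.le
  have h4 := norm_add_le (z - x - y) y
  rw [sub_add_cancel] at h4
  linarith

theorem exists_weakTendsto_subseq_pi {ι : Type*} [Fintype ι] {X : ι → Type*}
    [∀ i, NormedAddCommGroup (X i)] [∀ i, NormedSpace ℝ (X i)] (hX : ∀ i, IsReflexiveSpace (X i))
    {u : ℕ → ∀ i, X i} (hu : ∀ i, ∃ R : ℝ, ∀ n, ‖u n i‖ ≤ R) :
    ∃ (x : ∀ i, X i) (k : ℕ → ℕ), StrictMono k ∧ ∀ i, WeakTendsto (fun n => u (k n) i) (x i) := by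
  classical
  have key : ∀ s : Finset ι, ∃ k : ℕ → ℕ, StrictMono k ∧
      ∀ i ∈ s, ∃ x, WeakTendsto (fun n => u (k n) i) x := by
    intro s
    induction s using Finset.induction_on with
    | empty => exact ⟨id, strictMono_id, by simp⟩
    | insert i s _ ih =>
      obtain ⟨k, hk, h⟩ := ih
      obtain ⟨R, hR⟩ := hu i
      obtain ⟨x, j, hj, hx⟩ := exists_weakTendsto_subseq (hX i) (u := fun n => u (k n) i)
        fun n => hR (k n)
      refine ⟨k ∘ j, hk.comp hj, fun i' hi' => ?_⟩
      rcases Finset.mem_insert.1 hi' with rfl | hi'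
      · exact ⟨x, hx⟩
      · obtain ⟨y, hy⟩ := h i' hi'
        exact ⟨y, hy.comp hj.tendsto_atTop⟩
  obtain ⟨k, hk, h⟩ := key Finset.univ
  choose x hx using fun i => h i (Finset.mem_univ i)
  exact ⟨x, k, hk, hx⟩

end Weak

/-! ### Existence, uniqueness and optimality for the proximity operator. -/

section Prox

variable {E : Type*} [NormedAddCommGroup E] [NormedSpace ℝ E] {f g : E → EReal}

theorem effDom_const_mul {E : Type*} {g : E → EReal} {γ : ℝ} (hγ : 0 < γ) :
    effDom (fun x => (γ : EReal) * g x) = effDom g := by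
  ext x
  change (γ : EReal) * g x < ⊤ ↔ g x < ⊤
  induction h : g x using EReal.rec with
  | bot => simp [EReal.coe_mul_bot_of_pos hγ]
  | coe r => simp [← EReal.coe_mul]
  | top => simp [EReal.coe_mul_top_of_pos hγ]

theorem isGammaZero_const_mul (hg : IsGammaZero g) {γ : ℝ} (hγ : 0 < γ) :
    IsGammaZero fun x => (γ : EReal) * g x := by
  have hdom := effDom_const_mul (g := g) hγ
  have hreal : ∀ x ∈ effDom g, (γ : EReal) * g x = ((γ * (g x).toReal : ℝ) : EReal) :=
    fun x hx => by rw [EReal.coe_mul, hg.coe_toReal hx]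
  refine .of_comb_le (fun x => ?_) (hdom ▸ hg.dom_nonempty) ?_ ?_
  · rw [EReal.mul_ne_bot]
    simp [hg.ne_bot x, hγ.le]
  · have hc : Continuous fun y : EReal => (γ : EReal) * y := by
      refine continuous_iff_continuousAt.2 fun y => ?_
      have := EReal.continuousAt_mul (p := ((γ : EReal), y)) (.inl (by simpa using hγ.ne'))
        (.inl (by simpa using hγ.ne')) (.inl (by simp)) (.inl (by simp))
      exact this.comp (f := fun y : EReal => ((γ : EReal), y)) (by fun_prop)
    exact hc.comp_lowerSemicontinuous hg.lsc fun a b hab =>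
      mul_le_mul_of_nonneg_left hab (EReal.coe_nonneg.2 hγ.le)
  · intro x y r s a b ha hb hab hx hy
    have hx' : x ∈ effDom g := hdom ▸ mem_effDom_of_le hx
    have hy' : y ∈ effDom g := hdom ▸ mem_effDom_of_le hy
    rw [hreal x hx', EReal.coe_le_coe_iff] at hx
    rw [hreal y hy', EReal.coe_le_coe_iff] at hy
    rw [hreal _ (hg.comb_mem ha.le hb.le hab hx' hy'), EReal.coe_le_coe_iff]
    have h1 := mul_le_mul_of_nonneg_left (hg.toReal_comb_le ha.le hb.le hab hx' hy') hγ.le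
    have h2 := mul_le_mul_of_nonneg_left hx ha.le
    have h3 := mul_le_mul_of_nonneg_left hy hb.le
    linarith

theorem prox_value (hf : IsGammaZero f) (hg : IsGammaZero g) (u : StrongDual ℝ E) {x : E}
    (hx : x ∈ effDom f) (hx' : x ∈ effDom g) :
    g x + f x - ((u x : ℝ) : EReal) = (((g x).toReal + (f x).toReal - u x : ℝ) : EReal) := by
  rw [EReal.coe_sub, EReal.coe_add, hf.coe_toReal hx, hg.coe_toReal hx']

theorem prox_value_lt_top_iff (hf : IsGammaZero f) (hg : IsGammaZero g) (u : StrongDual ℝ E)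
    {x : E} : g x + f x - ((u x : ℝ) : EReal) < ⊤ ↔ x ∈ effDom f ∧ x ∈ effDom g := by
  constructor
  · intro h
    by_contra hn
    rw [not_and_or] at hn
    refine h.ne ?_
    rcases hn with hn | hn
    · have : f x = ⊤ := by simpa [effDom] using hn
      rw [this, EReal.add_top_of_ne_bot (hg.ne_bot x), EReal.top_sub_coe]
    · have : g x = ⊤ := by simpa [effDom] using hn
      rw [this, EReal.top_add_of_ne_bot (hf.ne_bot x), EReal.top_sub_coe]
  · rintro ⟨h1, h2⟩
    rw [prox_value hf hg u h1 h2]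
    exact EReal.coe_lt_top _

theorem isGammaZero_prox_value (hf : IsGammaZero f) (hg : IsGammaZero g) (u : StrongDual ℝ E)
    {z : E} (hz : z ∈ effDom f) (hz' : z ∈ effDom g) :
    IsGammaZero fun x => g x + f x - ((u x : ℝ) : EReal) := by
  refine .of_comb_le (fun x => ?_) ⟨z, (prox_value_lt_top_iff hf hg u).2 ⟨hz, hz'⟩⟩ ?_ ?_
  · rw [sub_eq_add_neg, ← EReal.coe_neg]
    simp [EReal.add_eq_bot_iff, hf.ne_bot x, hg.ne_bot x]
  · simp only [sub_eq_add_neg, ← EReal.coe_neg]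
    have hc : Continuous fun x => ((-u x : ℝ) : EReal) :=
      continuous_coe_real_ereal.comp (by fun_prop)
    refine LowerSemicontinuous.add' (hg.lsc.add' hf.lsc fun x => ?_) hc.lowerSemicontinuous
      fun x => ?_
    · exact EReal.continuousAt_add (.inr (hf.ne_bot x)) (.inl (hg.ne_bot x))
    · exact EReal.continuousAt_add (.inr (EReal.coe_ne_bot _)) (.inr (EReal.coe_ne_top _))
  · intro x y r s a b ha hb hab hx hy
    obtain ⟨hxf, hxg⟩ := (prox_value_lt_top_iff hf hg u).1 (hx.trans_lt (EReal.coe_lt_top r))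
    obtain ⟨hyf, hyg⟩ := (prox_value_lt_top_iff hf hg u).1 (hy.trans_lt (EReal.coe_lt_top s))
    rw [prox_value hf hg u hxf hxg, EReal.coe_le_coe_iff] at hx
    rw [prox_value hf hg u hyf hyg, EReal.coe_le_coe_iff] at hy
    rw [prox_value hf hg u (hf.comb_mem ha.le hb.le hab hxf hyf)
      (hg.comb_mem ha.le hb.le hab hxg hyg), EReal.coe_le_coe_iff]
    have h1 := hf.toReal_comb_le ha.le hb.le hab hxf hyf
    have h2 := hg.toReal_comb_le ha.le hb.le hab hxg hyg
    have h3 := mul_le_mul_of_nonneg_left hx ha.le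
    have h4 := mul_le_mul_of_nonneg_left hy hb.le
    simp only [map_add, map_smul, smul_eq_mul]
    linarith

theorem mem_prox_iff (hf : IsGammaZero f) (hg : IsGammaZero g) {u : StrongDual ℝ E} {x : E} :
    x ∈ prox f g u ↔ x ∈ effDom f ∧ x ∈ effDom g ∧ ∀ y ∈ effDom f, y ∈ effDom g →
      (g x).toReal + (f x).toReal - u x ≤ (g y).toReal + (f y).toReal - u y := by
  constructor
  · rintro ⟨h1, h2⟩
    obtain ⟨hxf, hxg⟩ := (prox_value_lt_top_iff hf hg u).1 h1
    refine ⟨hxf, hxg, fun y hyf hyg => ?_⟩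
    have := h2 y
    rwa [prox_value hf hg u hxf hxg, prox_value hf hg u hyf hyg, EReal.coe_le_coe_iff] at this
  · rintro ⟨hxf, hxg, h⟩
    refine ⟨(prox_value_lt_top_iff hf hg u).2 ⟨hxf, hxg⟩, fun y => ?_⟩
    by_cases hy : g y + f y - ((u y : ℝ) : EReal) < ⊤
    · obtain ⟨hyf, hyg⟩ := (prox_value_lt_top_iff hf hg u).1 hy
      rw [prox_value hf hg u hxf hxg, prox_value hf hg u hyf hyg, EReal.coe_le_coe_iff]
      exact h y hyf hyg
    · rw [not_lt_top_iff.1 hy]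
      exact le_top

/-- Coercive functions of `Γ₀` on a reflexive space attain their minimum. -/
theorem IsGammaZero.exists_isMin (hE : IsReflexiveSpace E) {h : E → EReal} (hh : IsGammaZero h)
    {ρ c : ℝ} (hρ : 0 < ρ) (hc : ∀ x ∈ effDom h, ρ * ‖x‖ - c ≤ (h x).toReal) :
    ∃ x, h x < ⊤ ∧ ∀ y, h x ≤ h y := by
  obtain ⟨v, hv, hlim, hmem⟩ := exists_seq_tendsto_sInf (hh.dom_nonempty.image h)
    (OrderBot.bddBelow _)
  choose x hxd hx using hmem
  have hbd : ∀ n, ‖x n‖ ≤ ((h (x 0)).toReal + c) / ρ := fun n => by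
    have h1 : h (x n) ≤ h (x 0) := by
      rw [hx, hx]
      exact hv (Nat.zero_le n)
    rw [← hh.coe_toReal (hxd 0), hh.le_coe_iff (hxd n)] at h1
    rw [le_div_iff₀ hρ]
    linarith [hc _ (hxd n)]
  obtain ⟨p, k, hk, hp⟩ := exists_weakTendsto_subseq hE hbd
  have hle : h p ≤ sInf (h '' effDom h) := by
    by_contra hlt
    obtain ⟨r, hr1, hr2⟩ := exists_between (not_le.1 hlt)
    have h1 := hh.eventually_lt hp hr2
    have h2 := (hlim.comp hk.tendsto_atTop).eventually (gt_mem_nhds hr1)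
    obtain ⟨n, hn1, hn2⟩ := (h1.and h2).exists
    simp only [Function.comp_apply, hx] at hn1 hn2
    exact lt_asymm hn1 hn2
  have hmin : ∀ y ∈ effDom h, h p ≤ h y := fun y hy => hle.trans (sInf_le ⟨y, hy, rfl⟩)
  obtain ⟨z, hz⟩ := hh.dom_nonempty
  refine ⟨p, (hmin z hz).trans_lt hz, fun y => ?_⟩
  by_cases hy : y ∈ effDom h
  · exact hmin y hy
  · have : h y = ⊤ := by simpa [effDom] using hy
    simp [this]

/-- The sum rule splits the optimality condition; the part in ∂f(x) can only be ∇f(x) and places x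
in the interior. -/
theorem IsLegendre.mem_interior_of_mem_prox [CompleteSpace E] (hL : IsLegendre f)
    (hf : IsGammaZero f) (hg : IsGammaZero g) {z : E} (hz : z ∈ interior (effDom f))
    (hz' : z ∈ effDom g) {u : StrongDual ℝ E} {x : E} (hx : x ∈ prox f g u) :
    x ∈ interior (effDom f) ∧ x ∈ effDom g ∧
      ∀ y ∈ effDom g, (g x).toReal + (u - grad f x) (y - x) ≤ (g y).toReal := by
  obtain ⟨hxf, hxg, hmin⟩ := (mem_prox_iff hf hg).1 hx
  obtain ⟨w, hw, hwg⟩ := hf.exists_mem_subdiff_of_isMin (C := effDom g)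
    (g := fun y => (g y).toReal + (-u) y)
    (hg.convexOn_toReal.add ((-u).toLinearMap.convexOn hg.convex_effDom)) hxf hxg hz hz'
    fun y hy hy' => by
      have := hmin y hy hy'
      simp only [neg_apply]
      linarith
  refine ⟨hL.mem_interior_of_mem_subdiff hf hw, hxg, fun y hy => ?_⟩
  have := hwg y hy
  rw [← hL.eq_grad hf hw]
  simp only [neg_apply, sub_apply, map_sub] at this ⊢
  linarith

theorem IsLegendre.prox_eq_singleton [CompleteSpace E] (hE : IsReflexiveSpace E)
    (hL : IsLegendre f) (hf : IsGammaZero f) (hg : IsGammaZero g) {z : E}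
    (hz : z ∈ interior (effDom f)) (hz' : z ∈ effDom g) {u : StrongDual ℝ E} {ρ c : ℝ}
    (hρ : 0 < ρ) (hc : ∀ x ∈ effDom f, x ∈ effDom g →
      ρ * ‖x‖ - c ≤ (g x).toReal + (f x).toReal - u x) :
    ∃ x, prox f g u = {x} := by
  obtain ⟨x, hx⟩ := (isGammaZero_prox_value hf hg u (interior_subset hz) hz').exists_isMin hE hρ
    (c := c) fun x hx => by
      obtain ⟨h1, h2⟩ := (prox_value_lt_top_iff hf hg u).1 hx
      rw [prox_value hf hg u h1 h2, EReal.toReal_coe]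
      exact hc x h1 h2
  have hxp : x ∈ prox f g u := hx
  refine ⟨x, Set.eq_singleton_iff_unique_mem.2 ⟨hxp, fun y hy => ?_⟩⟩
  obtain ⟨hxi, hxg, hxs⟩ := hL.mem_interior_of_mem_prox hf hg hz hz' hxp
  have hs := hL.grad_mem hf hxi
  obtain ⟨hyf, hyg, hymin⟩ := (mem_prox_iff hf hg).1 hy
  have h1 := hymin x (interior_subset hxi) hxg
  have h2 := hxs y hyg
  -- A second minimizer y has the same value, which forces ∇f(x) ∈ ∂f(y); injectivity of ∂f
  -- concludes.
  refine (hL.eq_of_mem_subdiff hf hs ((mem_subdiff_iff hf hyf).2 fun w hw => ?_)).symm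
  have h3 := hf.subdiff_le hs hw
  simp only [sub_apply, map_sub] at h2 h3 ⊢
  linarith

/-- Finite everywhere, f* is bounded above near w; the Young inequality at w + (r/2) l, with l
norming x, yields the growth. -/
theorem IsCofinite.exists_growth (hf : IsGammaZero f) (hcof : IsCofinite f)
    (w : StrongDual ℝ E) :
    ∃ ρ > 0, ∃ c : ℝ, ∀ x ∈ effDom f, w x + ρ * ‖x‖ - c ≤ (f x).toReal := by
  have hf' := isGammaZero_conj hf
  have hw : w ∈ interior (effDom (conj f)) := by
    rw [hcof, interior_univ]
    trivial
  obtain ⟨r, hr, M, hM⟩ := hf'.exists_ball_le hw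
  refine ⟨r / 2, half_pos hr, M, fun x hx => ?_⟩
  obtain ⟨l, hl1, hl2⟩ := exists_dual_vector'' ℝ x
  have hmem : w + (r / 2) • l ∈ Metric.ball w r := by
    rw [Metric.mem_ball, dist_eq_norm, add_sub_cancel_left, norm_smul, Real.norm_eq_abs,
      abs_of_pos (half_pos hr)]
    nlinarith
  have h := (conj_le_coe_iff hf).1 (hM _ hmem) x hx
  have hl : l x = ‖x‖ := hl2
  simp only [add_apply, smul_apply, smul_eq_mul, hl] at h
  linarith

theorem IsLegendre.prox_const_mul_eq_singleton [CompleteSpace E] (hE : IsReflexiveSpace E)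
    (hL : IsLegendre f) (hf : IsGammaZero f) (hg : IsGammaZero g)
    (hcof : IsCofinite f ∨ IsCofinite g) {z : E}
    (hz : z ∈ interior (effDom f)) (hz' : z ∈ effDom g) {γ : ℝ} (hγ : 0 < γ)
    (u : StrongDual ℝ E) : ∃ x, prox f (fun z => (γ : EReal) * g z) u = {x} := by
  have hdom := effDom_const_mul (g := g) hγ
  obtain ⟨ρ, hρ, c, h⟩ : ∃ ρ > 0, ∃ c : ℝ, ∀ x ∈ effDom f, x ∈ effDom g →
      ρ * ‖x‖ - c ≤ γ * (g x).toReal + (f x).toReal - u x := by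
    -- The cofinite function grows faster than any prescribed continuous linear functional, so it
    -- absorbs both u and the slope of an affine minorant of the other function.
    rcases hcof with hcof | hcof
    · obtain ⟨v, d, hv⟩ := hg.exists_affine_minorant
      obtain ⟨ρ, hρ, c, h⟩ := hcof.exists_growth hf (u - γ • v)
      refine ⟨ρ, hρ, c + γ * d, fun x hx hx' => ?_⟩
      have h1 := h x hx
      have h2 := mul_le_mul_of_nonneg_left (hv x hx') hγ.le
      simp only [sub_apply, smul_apply, smul_eq_mul] at h1
      linarith
    · obtain ⟨v, d, hv⟩ := hf.exists_affine_minorant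
      obtain ⟨ρ, hρ, c, h⟩ := hcof.exists_growth hg (γ⁻¹ • (u - v))
      refine ⟨γ * ρ, mul_pos hγ hρ, γ * c + d, fun x hx hx' => ?_⟩
      have h1 := hv x hx
      have h2 := mul_le_mul_of_nonneg_left (h x hx') hγ.le
      simp only [sub_apply, smul_apply, smul_eq_mul] at h2
      rw [mul_sub, mul_add, mul_inv_cancel_left₀ hγ.ne'] at h2
      linarith
  refine hL.prox_eq_singleton hE hf (isGammaZero_const_mul hg hγ) hz (hdom ▸ hz') hρ (c := c)
    fun x hx hx' => ?_
  rw [EReal.toReal_mul, EReal.toReal_coe]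
  exact h x hx (hdom ▸ hx')

theorem IsLegendre.of_mem_prox_const_mul [CompleteSpace E] (hL : IsLegendre f)
    (hf : IsGammaZero f) (hg : IsGammaZero g) {z : E} (hz : z ∈ interior (effDom f))
    (hz' : z ∈ effDom g) {γ : ℝ} (hγ : 0 < γ) {u : StrongDual ℝ E} {x : E}
    (hx : x ∈ prox f (fun z => (γ : EReal) * g z) u) :
    x ∈ interior (effDom f) ∧ x ∈ effDom g ∧
      ∀ y ∈ effDom g, γ * (g x).toReal + (u - grad f x) (y - x) ≤ γ * (g y).toReal := by
  have hdom := effDom_const_mul (g := g) hγ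
  have := hL.mem_interior_of_mem_prox hf (isGammaZero_const_mul hg hγ) hz (hdom ▸ hz') hx
  simpa only [hdom, EReal.toReal_mul, EReal.toReal_coe] using this

end Prox

/-! ### Real Bregman distances and extension of subadditivity to the boundary. -/

section RealBregman

variable {E : Type*} [NormedAddCommGroup E] [NormedSpace ℝ E] {f : E → EReal}

/-- The Bregman distance as a real number, meaningful for `x ∈ dom f`, `y ∈ int dom f`. -/
def realBregman (f : E → EReal) (x y : E) : ℝ :=
  (f x).toReal - (f y).toReal - grad f y (x - y)

theorem bregman_eq_coe (hbot : ∀ x, f x ≠ ⊥) {x y : E} (hx : x ∈ effDom f)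
    (hy : y ∈ interior (effDom f)) : bregman f x y = (realBregman f x y : EReal) := by
  rw [bregman, if_pos hy, realBregman, EReal.coe_sub, EReal.coe_sub,
    EReal.coe_toReal hx.ne (hbot x), EReal.coe_toReal (interior_subset hy).ne (hbot y)]

theorem IsGammaZero.realBregman_nonneg (hf : IsGammaZero f) {x y : E} (hx : x ∈ effDom f)
    (hy : GateauxDiffAt f y) : 0 ≤ realBregman f x y := by
  have := hf.subdiff_le (hf.grad_mem_subdiff hy) hx
  rw [realBregman]
  linarith

theorem tendsto_add_smul (a e : E) (c : ℝ) :
    Tendsto (fun t : ℝ => a + (c * t) • e) (𝓝[>] 0) (𝓝 a) := by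
  have : Continuous fun t : ℝ => a + (c * t) • e := by fun_prop
  simpa using (this.tendsto 0).mono_left nhdsWithin_le_nhds

/-- Continuity of a function of `Γ₀` along the segments of its domain. -/
theorem IsGammaZero.tendsto_ray (hf : IsGammaZero f) {a e : E} (ha : a ∈ effDom f)
    (he : ∀ᶠ t in 𝓝[>] (0 : ℝ), a + t • e ∈ effDom f) :
    Tendsto (fun t : ℝ => (f (a + t • e)).toReal) (𝓝[>] 0) (𝓝 (f a).toReal) := by
  obtain ⟨τ, hτ, hτ0⟩ := (he.and self_mem_nhdsWithin).exists
  have hτ0 : 0 < τ := hτ0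
  refine tendsto_order.2 ⟨fun r hr => ?_, fun r hr => ?_⟩
  · have hr' : (r : EReal) < f a := by
      rw [← hf.coe_toReal ha]
      exact EReal.coe_lt_coe_iff.2 hr
    have hlim : Tendsto (fun t : ℝ => a + t • e) (𝓝[>] 0) (𝓝 a) := by
      simpa using tendsto_add_smul a e 1
    filter_upwards [hlim.eventually (hf.lsc a r hr'), he] with t ht htd
    rw [← hf.coe_toReal htd] at ht
    exact EReal.coe_lt_coe_iff.1 ht
  · have hlim : Tendsto (fun t : ℝ => (1 - t / τ) * (f a).toReal + t / τ * (f (a + τ • e)).toReal)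
        (𝓝[>] 0) (𝓝 (f a).toReal) := by
      have : Continuous fun t : ℝ =>
        (1 - t / τ) * (f a).toReal + t / τ * (f (a + τ • e)).toReal := by fun_prop
      simpa using (this.tendsto 0).mono_left nhdsWithin_le_nhds
    filter_upwards [hlim.eventually (gt_mem_nhds hr), Ioo_mem_nhdsGT hτ0] with t ht ht0
    refine lt_of_le_of_lt ?_ ht
    have h1 : 0 ≤ 1 - t / τ := sub_nonneg.2 ((div_le_one hτ0).2 ht0.2.le)
    have h2 := hf.toReal_comb_le h1 (div_nonneg ht0.1.le hτ0.le) (by ring) ha hτ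
    have e1 : (1 - t / τ) • a + (t / τ) • (a + τ • e) = a + t • e := by
      have : t • e = (t / τ * τ) • e := by rw [div_mul_cancel₀ _ hτ0.ne']
      rw [this]
      module
    rwa [e1] at h2

theorem eventually_mem_of_mem_interior {U : Set E} {a : E} (ha : a ∈ interior U) (e : E) (c : ℝ) :
    ∀ᶠ t in 𝓝[>] (0 : ℝ), a + (c * t) • e ∈ interior U :=
  (tendsto_add_smul a e c).eventually (isOpen_interior.mem_nhds ha)

/-- Directional derivatives are dominated by difference quotients, along the perturbation
`a ↦ a + t • (c - a)`. -/
theorem IsGammaZero.grad_le_quotient (hf : IsGammaZero f) {a b c : E} {s t : ℝ} (hs : 0 < s)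
    (hdiff : GateauxDiffAt f (a + t • (c - a)))
    (hb : (a + s • b) + t • (c - (a + s • b)) ∈ effDom f) :
    grad f (a + t • (c - a)) ((1 - t) • b) ≤ s⁻¹ *
      ((f ((a + s • b) + t • (c - (a + s • b)))).toReal - (f (a + t • (c - a))).toReal) := by
  have h := hf.subdiff_le (hf.grad_mem_subdiff hdiff) hb
  have e : a + s • b + t • (c - (a + s • b)) - (a + t • (c - a)) = s • (1 - t) • b := by module
  rw [e, map_smul, smul_eq_mul] at h
  rw [le_inv_mul_iff₀ hs]
  linarith

/-- The subadditivity inequality for Bregman distances extends from interior points to points of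
the domain at which the relevant directional derivatives exist. -/
theorem IsGammaZero.realBregman_sum_le {ι : Type*} [Fintype ι] (hf : IsGammaZero f)
    (hdiff : ∀ y ∈ interior (effDom f), GateauxDiffAt f y) {σ : ℝ} (hσ : 0 ≤ σ)
    (hsub : ∀ y v : ι → E, (∀ i, y i ∈ interior (effDom f)) → (∀ i, v i ∈ interior (effDom f)) →
      ∑ i, y i ∈ interior (effDom f) → ∑ i, v i ∈ interior (effDom f) →
      realBregman f (∑ i, y i) (∑ i, v i) ≤ σ * ∑ i, realBregman f (y i) (v i))
    (hint : (interior (effDom f)).Nonempty) {p q : ι → E} {D : ι → ℝ}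
    (hp : ∀ i, p i ∈ effDom f) (hq : ∀ i, ∀ᶠ s in 𝓝 (0 : ℝ), q i + s • (p i - q i) ∈ effDom f)
    (hD : ∀ i, HasDerivAt (fun s : ℝ => (f (q i + s • (p i - q i))).toReal) (D i) 0)
    (hps : ∑ i, p i ∈ interior (effDom f)) (hqs : ∑ i, q i ∈ interior (effDom f)) :
    realBregman f (∑ i, p i) (∑ i, q i) ≤
      σ * ∑ i, ((f (p i)).toReal - (f (q i)).toReal - D i) := by
  obtain ⟨c, hc⟩ := hint
  set P := ∑ i, p i with hP
  set Q := ∑ i, q i with hQ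
  set N : ℝ := (Fintype.card ι : ℝ) with hN
  have hq0 : ∀ i, q i ∈ effDom f := fun i => by simpa using (hq i).self_of_nhds
  -- Moving each point towards c moves the sum towards N c, which may lie outside dom f; this is
  -- harmless for small t because the sums P and Q are interior.
  have hsumT : ∀ (a : ι → E) (t : ℝ),
      ∑ i, (a i + t • (c - a i)) = ∑ i, a i + t • (N • c - ∑ i, a i) := fun a t => by
    rw [Finset.sum_add_distrib, ← Finset.smul_sum, Finset.sum_sub_distrib, Finset.sum_const,
      Finset.card_univ, hN, Nat.cast_smul_eq_nsmul]
  have hTint : ∀ a ∈ effDom f, ∀ᶠ t in 𝓝[>] (0 : ℝ), a + t • (c - a) ∈ interior (effDom f) := by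
    intro a ha
    filter_upwards [Ioo_mem_nhdsGT (zero_lt_one' ℝ)] with t ht
    have := hf.convex_effDom.combo_self_interior_mem_interior ha hc
      (sub_nonneg.2 ht.2.le) ht.1 (by ring)
    have e : (1 - t) • a + t • c = a + t • (c - a) := by module
    rwa [e] at this
  have hT : ∀ a ∈ effDom f, Tendsto (fun t : ℝ => (f (a + t • (c - a))).toReal) (𝓝[>] 0)
      (𝓝 (f a).toReal) := fun a ha =>
    hf.tendsto_ray ha ((hTint a ha).mono fun t ht => interior_subset ht)
  have hSint : ∀ a ∈ interior (effDom f), ∀ᶠ t in 𝓝[>] (0 : ℝ),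
      a + t • (N • c - a) ∈ interior (effDom f) := fun a ha => by
    simpa using eventually_mem_of_mem_interior ha (N • c - a) 1
  have hS : ∀ a ∈ interior (effDom f), Tendsto (fun t : ℝ => (f (a + t • (N • c - a))).toReal)
      (𝓝[>] 0) (𝓝 (f a).toReal) := fun a ha =>
    hf.tendsto_ray (interior_subset ha) ((hSint a ha).mono fun t ht => interior_subset ht)
  -- Gradients at the perturbed points need not converge as t → 0, so they are first replaced by
  -- difference quotients with fixed step s, which do. The limit s → 0 comes afterwards.
  have hquot : ∀ s : ℝ, 0 < s → Q + s • (P - Q) ∈ interior (effDom f) →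
      (∀ i, q i + (-s) • (p i - q i) ∈ effDom f) →
      (f P).toReal - (f Q).toReal - s⁻¹ * ((f (Q + s • (P - Q))).toReal - (f Q).toReal) ≤
        σ * ∑ i, ((f (p i)).toReal - (f (q i)).toReal +
          s⁻¹ * ((f (q i + (-s) • (p i - q i))).toReal - (f (q i)).toReal)) := by
    intro s hs hQs hqs'
    refine le_of_tendsto_of_tendsto
      (((hS P hps).sub (hS Q hqs)).sub (((hS _ hQs).sub (hS Q hqs)).const_mul s⁻¹))
      ((tendsto_finsetSum Finset.univ fun i _ => ((hT _ (hp i)).sub (hT _ (hq0 i))).add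
        (((hT _ (hqs' i)).sub (hT _ (hq0 i))).const_mul s⁻¹)).const_mul σ) ?_
    filter_upwards [hSint P hps, hSint Q hqs, hSint _ hQs,
      eventually_all.2 fun i => hTint _ (hp i), eventually_all.2 fun i => hTint _ (hq0 i),
      eventually_all.2 fun i => hTint _ (hqs' i)] with t h1 h2 h3 h4 h5 h6
    have hkey := hsub (fun i => p i + t • (c - p i)) (fun i => q i + t • (c - q i)) h4 h5
      (by rw [hsumT]; exact h1) (by rw [hsumT]; exact h2)
    rw [hsumT, hsumT] at hkey
    have hL := hf.grad_le_quotient (b := P - Q) hs (hdiff _ h2) (interior_subset h3)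
    -- On the right the gradient enters with a minus sign, so the upper bound needs the backward
    -- quotient; on the left the forward one bounds the distance from below.
    have hR := fun i => hf.grad_le_quotient (a := q i) (b := -(p i - q i)) (c := c) hs
      (hdiff _ (h5 i)) (by simpa only [neg_smul, smul_neg] using interior_subset (h6 i))
    have e1 : P + t • (N • c - P) - (Q + t • (N • c - Q)) = (1 - t) • (P - Q) := by module
    have e2 : ∀ i, p i + t • (c - p i) - (q i + t • (c - q i)) = (1 - t) • (p i - q i) :=
      fun i => by module
    rw [realBregman, e1] at hkey
    refine le_trans (by linarith) (hkey.trans (mul_le_mul_of_nonneg_left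
      (Finset.sum_le_sum fun i _ => ?_) hσ))
    have h7 := hR i
    rw [smul_neg, map_neg, smul_neg, ← neg_smul] at h7
    rw [realBregman, e2]
    linarith
  have hlimP : Tendsto (fun s : ℝ => s⁻¹ * ((f (Q + s • (P - Q))).toReal - (f Q).toReal)) (𝓝[>] 0)
      (𝓝 (grad f Q (P - Q))) := by
    simpa using ((hasGateauxGradAt_grad (hdiff Q hqs)).2 (P - Q)).tendsto_slope_zero_right
  have hneg : Tendsto (fun s : ℝ => -s) (𝓝[>] 0) (𝓝[<] 0) := by
    simpa using tendsto_neg_nhdsGT (a := (0 : ℝ))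
  have hlimq : ∀ i, Tendsto (fun s : ℝ =>
      s⁻¹ * ((f (q i + (-s) • (p i - q i))).toReal - (f (q i)).toReal)) (𝓝[>] 0)
      (𝓝 (-D i)) := fun i => by
    have h1 := ((hD i).tendsto_slope_zero_left.comp hneg).neg
    refine h1.congr fun s => ?_
    simp [inv_neg]
  have hlim := le_of_tendsto_of_tendsto
    ((tendsto_const_nhds (x := (f P).toReal - (f Q).toReal)).sub hlimP)
    ((tendsto_finsetSum Finset.univ fun i _ =>
      (tendsto_const_nhds (x := (f (p i)).toReal - (f (q i)).toReal)).add (hlimq i)).const_mul σ) (by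
    have h1 : ∀ᶠ s in 𝓝[>] (0 : ℝ), Q + s • (P - Q) ∈ interior (effDom f) := by
      simpa using eventually_mem_of_mem_interior hqs (P - Q) 1
    have h2 : ∀ i, ∀ᶠ s in 𝓝[>] (0 : ℝ), q i + (-s) • (p i - q i) ∈ effDom f := fun i =>
      (hneg.mono_right nhdsWithin_le_nhds).eventually (hq i)
    filter_upwards [h1, eventually_all.2 h2, self_mem_nhdsWithin] with s hs1 hs2 hs3
    exact hquot s hs3 hs1 hs2)
  simpa only [realBregman, ← sub_eq_add_neg] using hlim

end RealBregman

/-! ### Boundedness and interiority of weak limits. -/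

section Limits

variable {E : Type*} [NormedAddCommGroup E] [NormedSpace ℝ E] {f : E → EReal}

theorem IsLegendre.eq_of_realBregman_eq_zero (hL : IsLegendre f) (hf : IsGammaZero f) {x y : E}
    (hx : x ∈ effDom f) (hy : y ∈ interior (effDom f)) (h : realBregman f x y = 0) : x = y := by
  have hy' := hL.grad_mem hf hy
  refine hL.eq_of_mem_subdiff hf ((mem_subdiff_iff hf hx).2 fun w hw => ?_) hy'
  have h1 := hf.subdiff_le hy' hw
  rw [realBregman] at h
  simp only [map_sub] at h h1 ⊢
  linarith

theorem exists_norm_le_of_coercive (hbot : ∀ x, f x ≠ ⊥) {z : E} (hz : z ∈ effDom f)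
    (hc : IsCoerciveFun (bregman f z)) (C : ℝ) :
    ∃ R : ℝ, ∀ y ∈ interior (effDom f), realBregman f z y ≤ C → ‖y‖ ≤ R := by
  have h : ∀ᶠ y in Bornology.cobounded E, (C : EReal) < bregman f z y :=
    hc.eventually (lt_mem_nhds (EReal.coe_lt_top C))
  have hb : Bornology.IsBounded {y | (C : EReal) < bregman f z y}ᶜ :=
    Bornology.isBounded_def.2 (by rwa [compl_compl])
  obtain ⟨R, hR⟩ := hb.exists_norm_le
  refine ⟨R, fun y hy hyC => hR y ?_⟩
  rw [Set.mem_compl_iff, Set.mem_ofPred_eq, bregman_eq_coe hbot hz hy, EReal.coe_lt_coe_iff]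
  exact not_lt.2 hyC

/-- If `dom f*` is open and `∇f*` is weakly sequentially continuous, a weak limit along which the
Bregman distance to an interior point is bounded belongs to `int dom f`. -/
theorem IsLegendre.mem_interior_of_weakTendsto [CompleteSpace E] (hE : IsReflexiveSpace E)
    (hL : IsLegendre f) (hf : IsGammaZero f) (hopen : IsOpen (effDom (conj f)))
    (hw : GradWeakSeqCont (conj f)) {z y : E} (hz : z ∈ interior (effDom f)) {x : ℕ → E}
    (hx : ∀ n, x n ∈ interior (effDom f)) {C : ℝ} (hC : ∀ n, realBregman f z (x n) ≤ C)
    (hxy : WeakTendsto x y) : y ∈ interior (effDom f) := by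
  have hf' := isGammaZero_conj hf
  -- D(z, x_n) = f(z) + f*(∇f(x_n)) - ⟨z, ∇f(x_n)⟩, and f* - z is coercive as z is interior: the
  -- gradients are bounded.
  have hconj : ∀ n, (conj f (grad f (x n))).toReal ≤ grad f (x n) z + (C - (f z).toReal) :=
    fun n => by
    have h1 := (mem_subdiff_iff_conj hf (interior_subset (hx n))).1 (hL.grad_mem hf (hx n))
    rw [hf'.le_coe_iff (hL.grad_mem_effDom_conj hf (hx n))] at h1
    have h2 := hC n
    rw [realBregman, map_sub] at h2
    linarith
  obtain ⟨r, hr, M, hM⟩ := hf.exists_ball_le hz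
  have hbd : ∀ n, ‖grad f (x n)‖ ≤ (C - (f z).toReal + M) / (r / 2) := fun n => by
    rw [le_div_iff₀ (half_pos hr)]
    have := norm_le_of_ball_le hf hr hM (hL.grad_mem_effDom_conj hf (hx n))
    linarith [hconj n]
  obtain ⟨u, k, hk, hu⟩ := exists_weakTendsto_subseq (isReflexiveSpace_dual hE) hbd
  have hud : u ∈ effDom (conj f) := by
    by_contra hn
    have htop : conj f u = ⊤ := by simpa [effDom] using hn
    have h1 := hf'.eventually_lt hu (r := ((u z + 1 + (C - (f z).toReal) : ℝ) : EReal))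
      (by rw [htop]; exact EReal.coe_lt_top _)
    have h2 := (weakTendsto_iff.1 hu (NormedSpace.inclusionInDoubleDual ℝ E z)).eventually
      (gt_mem_nhds (lt_add_one _))
    obtain ⟨n, hn1, hn2⟩ := (h1.and h2).exists
    simp only [Function.comp_apply, NormedSpace.dual_def] at hn1 hn2
    rw [← hf'.coe_toReal (hL.grad_mem_effDom_conj hf (hx (k n))), EReal.coe_lt_coe_iff] at hn1
    linarith [hconj (k n)]
  obtain ⟨y', hy', hgrad⟩ := hL.exists_mem_subdiff_of_conj hE hf (hopen.interior_eq.symm ▸ hud)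
  have hmem : ∀ n, grad f (x (k n)) ∈ interior (effDom (conj f)) := fun n =>
    hopen.interior_eq.symm ▸ hL.grad_mem_effDom_conj hf (hx (k n))
  have hlim := hw _ u hmem (hopen.interior_eq.symm ▸ hud) hu
  rw [hgrad] at hlim
  -- Here x_n = ∇f*(∇f(x_n)) converges weakly to y', a point with a subgradient, so the weak limit y
  -- equals y'.
  have hlim' : WeakTendsto (fun n => x (k n)) y' := weakTendsto_iff.2 fun w => by
    have := weakTendsto_iff.1 hlim
      (NormedSpace.inclusionInDoubleDual ℝ (StrongDual ℝ E) w)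
    simp only [NormedSpace.dual_def] at this
    refine this.congr fun n => ?_
    rw [hL.grad_conj_grad hE hf (hx (k n)) (hmem n), NormedSpace.dual_def]
  rw [(hxy.comp hk.tendsto_atTop).unique hlim']
  exact hL.mem_interior_of_mem_subdiff hf hy'

end Limits

/-! ### The objective, its weak lower semicontinuity and relative smoothness. -/

section Objective

variable {ι κ : Type*} [Fintype ι] [Fintype κ] {X : ι → Type*} {Y : κ → Type*}
  [∀ i, NormedAddCommGroup (X i)] [∀ i, NormedSpace ℝ (X i)]
  [∀ k, NormedAddCommGroup (Y k)] [∀ k, NormedSpace ℝ (Y k)]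
  {φ : ∀ i, X i → EReal} {ψ : ∀ k, Y k → EReal} {L : ∀ i k, X i →L[ℝ] Y k}
  {f : ∀ i, X i → EReal}

theorem sum_coe_ereal {α : Type*} (s : Finset α) (a : α → ℝ) :
    ∑ i ∈ s, (a i : EReal) = ((∑ i ∈ s, a i : ℝ) : EReal) := by
  classical
  induction s using Finset.induction_on with
  | empty => simp
  | insert i s hi ih => rw [Finset.sum_insert hi, Finset.sum_insert hi, ih, EReal.coe_add]

theorem sum_ereal_ne_bot {α : Type*} {s : Finset α} {a : α → EReal} (h : ∀ i ∈ s, a i ≠ ⊥) :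
    ∑ i ∈ s, a i ≠ ⊥ := by
  classical
  induction s using Finset.induction_on with
  | empty => simp
  | insert i s hi ih =>
    rw [Finset.sum_insert hi, Ne, EReal.add_eq_bot_iff, not_or]
    exact ⟨h i (Finset.mem_insert_self i s), ih fun j hj => h j (Finset.mem_insert_of_mem hj)⟩

theorem lt_top_of_sum_lt_top {α : Type*} {s : Finset α} {a : α → EReal} (h : ∀ i ∈ s, a i ≠ ⊥)
    (hs : ∑ i ∈ s, a i < ⊤) : ∀ i ∈ s, a i < ⊤ := by
  classical
  intro i hi
  by_contra hn
  rw [← Finset.add_sum_erase s a hi, not_lt_top_iff.1 hn, EReal.top_add_of_ne_bot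
    (sum_ereal_ne_bot fun j hj => h j (Finset.mem_of_mem_erase hj))] at hs
  exact lt_irrefl _ hs

/-- The objective function as a real number, meaningful on its domain. -/
def realObjective (φ : ∀ i, X i → EReal) (ψ : ∀ k, Y k → EReal)
    (L : ∀ i k, X i →L[ℝ] Y k) (x : ∀ i, X i) : ℝ :=
  ∑ i, (φ i (x i)).toReal + ∑ k, (ψ k (∑ i, L i k (x i))).toReal

theorem objective_eq_coe (hφ : ∀ i, IsGammaZero (φ i)) (hψ : ∀ k, IsGammaZero (ψ k))
    {x : ∀ i, X i} (hx : ∀ i, x i ∈ effDom (φ i)) (hx' : ∀ k, ∑ i, L i k (x i) ∈ effDom (ψ k)) :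
    objective φ ψ L x = (realObjective φ ψ L x : EReal) := by
  rw [objective, realObjective, EReal.coe_add, ← sum_coe_ereal, ← sum_coe_ereal]
  congr 1
  · exact Finset.sum_congr rfl fun i _ => ((hφ i).coe_toReal (hx i)).symm
  · exact Finset.sum_congr rfl fun k _ => ((hψ k).coe_toReal (hx' k)).symm

theorem mem_effDom_of_objective_lt_top (hφ : ∀ i, IsGammaZero (φ i))
    (hψ : ∀ k, IsGammaZero (ψ k)) {x : ∀ i, X i} (h : objective φ ψ L x < ⊤) :
    (∀ i, x i ∈ effDom (φ i)) ∧ ∀ k, ∑ i, L i k (x i) ∈ effDom (ψ k) := by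
  have h1 : ∀ i ∈ Finset.univ, φ i (x i) ≠ ⊥ := fun i _ => (hφ i).ne_bot _
  have h2 : ∀ k ∈ Finset.univ, ψ k (∑ i, L i k (x i)) ≠ ⊥ := fun k _ => (hψ k).ne_bot _
  rw [objective, lt_top_iff_ne_top,
    EReal.add_ne_top_iff_ne_top₂ (sum_ereal_ne_bot h1) (sum_ereal_ne_bot h2)] at h
  exact ⟨fun i => lt_top_of_sum_lt_top h1 (lt_top_iff_ne_top.2 h.1) i (Finset.mem_univ i),
    fun k => lt_top_of_sum_lt_top h2 (lt_top_iff_ne_top.2 h.2) k (Finset.mem_univ k)⟩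

theorem eventually_lt_add {a b : EReal} {u v : ℕ → EReal}
    (hu : ∀ r < a, ∀ᶠ n in atTop, r < u n) (hv : ∀ r < b, ∀ᶠ n in atTop, r < v n) :
    ∀ r < a + b, ∀ᶠ n in atTop, r < u n + v n := by
  intro r hr
  obtain ⟨a', ha', b', hb', h⟩ : ∃ a' < a, ∃ b' < b, r < a' + b' := by
    by_contra hn
    push Not at hn
    exact absurd (EReal.add_le_of_forall_lt hn) (not_le.2 hr)
  filter_upwards [hu a' ha', hv b' hb'] with n h1 h2
  exact h.trans_le (add_le_add h1.le h2.le)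

theorem eventually_lt_sum {α : Type*} {s : Finset α} {a : α → EReal} {u : α → ℕ → EReal}
    (hu : ∀ i ∈ s, ∀ r < a i, ∀ᶠ n in atTop, r < u i n) :
    ∀ r < ∑ i ∈ s, a i, ∀ᶠ n in atTop, r < ∑ i ∈ s, u i n := by
  classical
  induction s using Finset.induction_on with
  | empty => exact fun r hr => Eventually.of_forall fun _ => hr
  | insert i s hi ih =>
    simp only [Finset.sum_insert hi]
    exact eventually_lt_add (hu i (Finset.mem_insert_self i s))
      (ih fun j hj => hu j (Finset.mem_insert_of_mem hj))

/-- The objective function is weakly sequentially lower semicontinuous. -/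
theorem eventually_lt_objective (hφ : ∀ i, IsGammaZero (φ i)) (hψ : ∀ k, IsGammaZero (ψ k))
    {x : ℕ → ∀ i, X i} {y : ∀ i, X i} (h : ∀ i, WeakTendsto (fun n => x n i) (y i)) :
    ∀ r < objective φ ψ L y, ∀ᶠ n in atTop, r < objective φ ψ L (x n) :=
  eventually_lt_add (eventually_lt_sum fun i _ _ hr => (hφ i).eventually_lt (h i) hr)
    (eventually_lt_sum fun k _ _ hr => (hψ k).eventually_lt
      (WeakTendsto.sum fun i _ => (h i).map (L i k)) hr)

theorem mem_solutions_of_weakTendsto (hφ : ∀ i, IsGammaZero (φ i)) (hψ : ∀ k, IsGammaZero (ψ k))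
    {x : ℕ → ∀ i, X i} {y z : ∀ i, X i} (hz : z ∈ solutions φ ψ L)
    (h : ∀ i, WeakTendsto (fun n => x n i) (y i))
    (hlim : Tendsto (fun n => objective φ ψ L (x n)) atTop (𝓝 (objective φ ψ L z))) :
    y ∈ solutions φ ψ L := by
  have hle : objective φ ψ L y ≤ objective φ ψ L z := by
    by_contra hlt
    obtain ⟨r, hr1, hr2⟩ := exists_between (not_le.1 hlt)
    obtain ⟨n, hn1, hn2⟩ := ((eventually_lt_objective hφ hψ h r hr2).and
      (hlim.eventually (gt_mem_nhds hr1))).exists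
    exact lt_asymm hn1 hn2
  exact ⟨hle.trans_lt hz.1, fun w => hle.trans (hz.2 w)⟩

/-- The derivative D along the segment replaces ∇ψ(A y): only ψ ∘ A is known to be differentiable at
y, and A y may be a boundary point of dom ψ. -/
theorem realBregman_le_of_bregmanGE {E F : Type*} [NormedAddCommGroup E] [NormedSpace ℝ E]
    [NormedAddCommGroup F] [NormedSpace ℝ F] {f : E → EReal} {ψ : F → EReal}
    (hf : IsGammaZero f) (hψ : IsGammaZero ψ) {A : E →L[ℝ] F} {b : ℝ} (hb : 0 < b)
    (hdom : BregmanGE f fun z => (b : EReal) * ψ (A z)) {x y : E}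
    (hx : x ∈ interior (effDom f)) (hy : y ∈ interior (effDom f)) :
    A x ∈ effDom ψ ∧ (∀ᶠ s in 𝓝 (0 : ℝ), A y + s • (A x - A y) ∈ effDom ψ) ∧
      ∃ D, HasDerivAt (fun s : ℝ => (ψ (A y + s • (A x - A y))).toReal) D 0 ∧
        (ψ (A x)).toReal - (ψ (A y)).toReal - D ≤ b⁻¹ * realBregman f x y := by
  set g : E → EReal := fun z => (b : EReal) * ψ (A z) with hg
  have hgdom : ∀ z, z ∈ effDom g ↔ A z ∈ effDom ψ := fun z =>
    Set.ext_iff.1 (effDom_const_mul (g := fun z => ψ (A z)) hb) z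
  have hgbot : ∀ z, g z ≠ ⊥ := fun z => by
    rw [hg, EReal.mul_ne_bot]
    simp [hψ.ne_bot, hb.le]
  have hgreal : ∀ z, (g z).toReal = b * (ψ (A z)).toReal := fun z => by
    rw [hg, EReal.toReal_mul, EReal.toReal_coe]
  have hint : ∀ z ∈ interior (effDom f), z ∈ interior (effDom g) := fun z hz =>
    (hasGateauxGradAt_grad (hdom.1 z hz)).1
  have hxg := hint x hx
  have hyg := hint y hy
  have hA : ∀ s : ℝ, A (y + s • (x - y)) = A y + s • (A x - A y) := fun s => by simp
  refine ⟨(hgdom x).1 (interior_subset hxg), ?_, b⁻¹ * grad g y (x - y), ?_, ?_⟩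
  · have hc : Tendsto (fun s : ℝ => y + s • (x - y)) (𝓝 0) (𝓝 y) := by
      have : Continuous fun s : ℝ => y + s • (x - y) := by fun_prop
      simpa using this.tendsto 0
    filter_upwards [hc.eventually (mem_interior_iff_mem_nhds.1 hyg)] with s hs
    rw [← hA]
    exact (hgdom _).1 hs
  · have h := ((hasGateauxGradAt_grad (hdom.1 y hy)).2 (x - y)).const_mul b⁻¹
    refine h.congr_of_eventuallyEq (Eventually.of_forall fun s => ?_)
    simp only [hgreal, hA, inv_mul_cancel_left₀ hb.ne']
  · have h := hdom.2 x (interior_subset hx) y hy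
    rw [bregman_eq_coe hgbot (interior_subset hxg) hyg,
      bregman_eq_coe hf.ne_bot (interior_subset hx) hy, EReal.coe_le_coe_iff, realBregman,
      hgreal, hgreal] at h
    rw [le_inv_mul_iff₀ hb, mul_sub, mul_inv_cancel_left₀ hb.ne']
    linarith

/-- The smooth part of the problem is `S`-smooth relatively to `∑ᵢ fᵢ`. -/
theorem sum_realBregman_le [Nonempty ι] (hψ : ∀ k, IsGammaZero (ψ k))
    (hψ_int : ∀ k, (interior (effDom (ψ k))).Nonempty)
    (hψ_diff : ∀ k, ∀ y ∈ interior (effDom (ψ k)), GateauxDiffAt (ψ k) y)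
    {σ : κ → ℝ} (hσ : ∀ k, 0 < σ k)
    (hsub : ∀ k, ∀ y v : ι → Y k,
      (∀ i, y i ∈ interior (effDom (ψ k))) → (∀ i, v i ∈ interior (effDom (ψ k))) →
      ∑ i, y i ∈ interior (effDom (ψ k)) → ∑ i, v i ∈ interior (effDom (ψ k)) →
      bregman (ψ k) (∑ i, y i) (∑ i, v i) ≤ (σ k : EReal) * ∑ i, bregman (ψ k) (y i) (v i))
    (hf : ∀ i, IsGammaZero (f i)) (hfL : ∀ i, IsLegendre (f i))
    (hL : ∀ k, ∀ x : ∀ i, X i, (∀ i, x i ∈ interior (effDom (f i))) →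
      ∑ i, L i k (x i) ∈ interior (effDom (ψ k)))
    {β : ι → κ → ℝ} (hβ : ∀ i k, 0 < β i k)
    (hdom : ∀ i k, BregmanGE (f i) (fun z => (β i k : EReal) * ψ k (L i k z)))
    {x y : ∀ i, X i} (hx : ∀ i, x i ∈ interior (effDom (f i)))
    (hy : ∀ i, y i ∈ interior (effDom (f i))) :
    ∑ k, realBregman (ψ k) (∑ i, L i k (x i)) (∑ i, L i k (y i)) ≤
      (∑ k, σ k * (Finset.univ.inf' Finset.univ_nonempty fun i => β i k)⁻¹) *
        ∑ i, realBregman (f i) (x i) (y i) := by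
  rw [Finset.sum_mul]
  refine Finset.sum_le_sum fun k _ => ?_
  choose hp hq D hD hle using fun i => realBregman_le_of_bregmanGE (hf i) (hψ k) (hβ i k)
    (hdom i k) (hx i) (hy i)
  have hsub' : ∀ y v : ι → Y k,
      (∀ i, y i ∈ interior (effDom (ψ k))) → (∀ i, v i ∈ interior (effDom (ψ k))) →
      ∑ i, y i ∈ interior (effDom (ψ k)) → ∑ i, v i ∈ interior (effDom (ψ k)) →
      realBregman (ψ k) (∑ i, y i) (∑ i, v i) ≤ σ k * ∑ i, realBregman (ψ k) (y i) (v i) := by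
    intro y v hy hv hys hvs
    have h := hsub k y v hy hv hys hvs
    rw [bregman_eq_coe (hψ k).ne_bot (interior_subset hys) hvs, Finset.sum_congr rfl fun i _ =>
      bregman_eq_coe (hψ k).ne_bot (interior_subset (hy i)) (hv i), sum_coe_ereal,
      ← EReal.coe_mul, EReal.coe_le_coe_iff] at h
    exact h
  refine ((hψ k).realBregman_sum_le (hψ_diff k) (hσ k).le hsub' (hψ_int k) hp hq hD (hL k x hx)
    (hL k y hy)).trans ?_
  rw [mul_assoc, Finset.mul_sum (Finset.univ) (fun i => realBregman (f i) (x i) (y i))]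
  refine mul_le_mul_of_nonneg_left (Finset.sum_le_sum fun i _ => (hle i).trans ?_) (hσ k).le
  refine mul_le_mul_of_nonneg_right ?_
    ((hf i).realBregman_nonneg (interior_subset (hx i)) ((hfL i).gateaux _ (hy i)))
  refine inv_anti₀ ((Finset.lt_inf'_iff _).2 fun i _ => hβ i k) (Finset.inf'_le _ (Finset.mem_univ i))

end Objective

/-! ### The descent inequality and uniqueness of weak cluster points. -/

section Iteration

variable {ι κ : Type*} [Fintype ι] [Fintype κ] {X : ι → Type*} {Y : κ → Type*}
  [∀ i, NormedAddCommGroup (X i)] [∀ i, NormedSpace ℝ (X i)]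
  [∀ k, NormedAddCommGroup (Y k)] [∀ k, NormedSpace ℝ (Y k)]
  {φ : ∀ i, X i → EReal} {ψ : ∀ k, Y k → EReal} {L : ∀ i k, X i →L[ℝ] Y k}
  {f : ∀ i, X i → EReal}

/-- The basic descent inequality of one forward-backward step from `x` to `x'`. -/
theorem descent_step (hψ : ∀ k, IsGammaZero (ψ k)) {γ S : ℝ} (hγ : 0 ≤ γ) {x x' z : ∀ i, X i}
    (hψx : ∀ k, GateauxDiffAt (ψ k) (∑ i, L i k (x i)))
    (hback : ∀ i, γ * (φ i (x' i)).toReal +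
      (forwardStep f ψ L γ x i - grad (f i) (x' i)) (z i - x' i) ≤ γ * (φ i (z i)).toReal)
    (hsmooth : ∑ k, realBregman (ψ k) (∑ i, L i k (x' i)) (∑ i, L i k (x i)) ≤
      S * ∑ i, realBregman (f i) (x' i) (x i))
    (hz : ∀ k, ∑ i, L i k (z i) ∈ effDom (ψ k)) :
    γ * (realObjective φ ψ L x' - realObjective φ ψ L z) +
      ∑ i, realBregman (f i) (z i) (x' i) + (1 - γ * S) * ∑ i, realBregman (f i) (x' i) (x i) ≤
      ∑ i, realBregman (f i) (z i) (x i) := by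
  set G : κ → ℝ := fun k => grad (ψ k) (∑ j, L j k (x j)) (∑ i, L i k (z i) - ∑ i, L i k (x' i))
    with hG
  -- Three-point identity for the `f i` part; the adjoint terms recombine into the gradients of the
  -- `ψ k` at ∑ L x.
  have hfwd : ∀ i, (forwardStep f ψ L γ x i - grad (f i) (x' i)) (z i - x' i) =
      (realBregman (f i) (z i) (x' i) + realBregman (f i) (x' i) (x i) -
        realBregman (f i) (z i) (x i)) -
      γ * ∑ k, grad (ψ k) (∑ j, L j k (x j)) (L i k (z i) - L i k (x' i)) := fun i => by
    simp only [forwardStep, realBregman, sub_apply, smul_apply, sum_apply, smul_eq_mul,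
      ContinuousLinearMap.comp_apply, map_sub, Finset.sum_sub_distrib]
    ring
  have hGsum : ∑ i, ∑ k, grad (ψ k) (∑ j, L j k (x j)) (L i k (z i) - L i k (x' i)) =
      ∑ k, G k := by
    rw [Finset.sum_comm]
    refine Finset.sum_congr rfl fun k _ => ?_
    simp only [hG, ← Finset.sum_sub_distrib, map_sum]
  have hsum := Finset.sum_le_sum fun i (_ : i ∈ Finset.univ) => hback i
  simp only [hfwd, Finset.sum_add_distrib, Finset.sum_sub_distrib, ← Finset.mul_sum] at hsum
  rw [hGsum] at hsum
  have hk : ∀ k, (ψ k (∑ i, L i k (x' i))).toReal + G k -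
      realBregman (ψ k) (∑ i, L i k (x' i)) (∑ i, L i k (x i)) ≤
      (ψ k (∑ i, L i k (z i))).toReal := fun k => by
    have h := (hψ k).subdiff_le ((hψ k).grad_mem_subdiff (hψx k)) (hz k)
    rw [hG, realBregman]
    simp only [map_sub] at h ⊢
    linarith
  have hksum := Finset.sum_le_sum fun k (_ : k ∈ Finset.univ) => hk k
  simp only [Finset.sum_add_distrib, Finset.sum_sub_distrib] at hksum
  have h1 := mul_le_mul_of_nonneg_left hksum hγ
  have h2 := mul_le_mul_of_nonneg_left hsmooth hγ
  rw [realObjective, realObjective]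
  linarith

/-- A nonnegative sequence whose decrease dominates `ε v` forces `v → 0`. -/
theorem tendsto_of_decrease {a v : ℕ → ℝ} {ε : ℝ} (hε : 0 < ε) (ha : ∀ n, 0 ≤ a n)
    (hv : ∀ n, 0 ≤ v n) (h : ∀ n, ε * v n + a (n + 1) ≤ a n) :
    (∃ l, Tendsto a atTop (𝓝 l)) ∧ Tendsto v atTop (𝓝 0) := by
  have hanti : Antitone a := antitone_nat_of_succ_le fun n => by
    linarith [h n, mul_nonneg hε.le (hv n)]
  have hl := tendsto_atTop_ciInf hanti ⟨0, by rintro _ ⟨n, rfl⟩; exact ha n⟩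
  refine ⟨⟨_, hl⟩, ?_⟩
  have h0 : Tendsto (fun n => ε⁻¹ * (a n - a (n + 1))) atTop (𝓝 0) := by
    simpa using (hl.sub (hl.comp (tendsto_add_atTop_nat 1))).const_mul ε⁻¹
  refine squeeze_zero hv (fun n => ?_) h0
  rw [le_inv_mul_iff₀ hε]
  linarith [h n]

/-- Two weak cluster points of a sequence at which the Bregman distances converge coincide. -/
theorem eq_of_weakTendsto_of_tendsto_realBregman (hf : ∀ i, IsGammaZero (f i))
    (hfL : ∀ i, IsLegendre (f i)) (hweak : ∀ i, GradWeakSeqCont (f i)) {x : ℕ → ∀ i, X i}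
    (hx : ∀ n i, x n i ∈ interior (effDom (f i))) {y z : ∀ i, X i}
    (hy : ∀ i, y i ∈ interior (effDom (f i))) (hz : ∀ i, z i ∈ interior (effDom (f i)))
    {l l' : ℝ} (hly : Tendsto (fun n => ∑ i, realBregman (f i) (y i) (x n i)) atTop (𝓝 l))
    (hlz : Tendsto (fun n => ∑ i, realBregman (f i) (z i) (x n i)) atTop (𝓝 l'))
    {k k' : ℕ → ℕ} (hk : Tendsto k atTop atTop) (hk' : Tendsto k' atTop atTop)
    (hky : ∀ i, WeakTendsto (fun n => x (k n) i) (y i))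
    (hkz : ∀ i, WeakTendsto (fun n => x (k' n) i) (z i)) : y = z := by
  have hg : ∀ n, ∑ i, grad (f i) (x n i) (y i - z i) =
      ∑ i, ((f i (y i)).toReal - (f i (z i)).toReal) -
        (∑ i, realBregman (f i) (y i) (x n i) - ∑ i, realBregman (f i) (z i) (x n i)) := by
    intro n
    rw [← Finset.sum_sub_distrib, ← Finset.sum_sub_distrib]
    refine Finset.sum_congr rfl fun i _ => ?_
    simp only [realBregman, map_sub]
    ring
  have hlim : Tendsto (fun n => ∑ i, grad (f i) (x n i) (y i - z i)) atTop
      (𝓝 (∑ i, ((f i (y i)).toReal - (f i (z i)).toReal) - (l - l'))) :=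
    ((hly.sub hlz).const_sub _).congr fun n => (hg n).symm
  have hcl : ∀ (j : ℕ → ℕ) (w : ∀ i, X i), (∀ i, w i ∈ interior (effDom (f i))) →
      (∀ i, WeakTendsto (fun n => x (j n) i) (w i)) →
      Tendsto (fun n => ∑ i, grad (f i) (x (j n) i) (y i - z i)) atTop
        (𝓝 (∑ i, grad (f i) (w i) (y i - z i))) := fun j w hw hjw =>
    tendsto_finsetSum _ fun i _ => weakTendsto_iff.1
      (hweak i _ _ (fun n => hx (j n) i) (hw i) (hjw i))
      (NormedSpace.inclusionInDoubleDual ℝ (X i) (y i - z i))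
  have heq := (tendsto_nhds_unique (hcl k y hy hky) (hlim.comp hk)).trans
    (tendsto_nhds_unique (hcl k' z hz hkz) (hlim.comp hk')).symm
  have hn1 := fun i => (hf i).realBregman_nonneg (interior_subset (hy i)) ((hfL i).gateaux _ (hz i))
  have hn2 := fun i => (hf i).realBregman_nonneg (interior_subset (hz i)) ((hfL i).gateaux _ (hy i))
  -- The symmetrized Bregman distance is ∇f(y) - ∇f(z) applied to y - z.
  have hzero : ∑ i, (realBregman (f i) (y i) (z i) + realBregman (f i) (z i) (y i)) = 0 := by
    rw [← sub_eq_zero.2 heq, ← Finset.sum_sub_distrib]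
    refine Finset.sum_congr rfl fun i _ => ?_
    simp only [realBregman, map_sub]
    ring
  funext i
  have := (Finset.sum_eq_zero_iff_of_nonneg fun i _ => add_nonneg (hn1 i) (hn2 i)).1 hzero i
    (Finset.mem_univ i)
  exact (hfL i).eq_of_realBregman_eq_zero (hf i) (interior_subset (hy i)) (hz i)
    (by linarith [hn1 i, hn2 i])

/-- A bounded sequence all of whose weak cluster points are equal converges weakly. -/
theorem weakTendsto_of_unique_cluster (hX : ∀ i, IsReflexiveSpace (X i)) {x : ℕ → ∀ i, X i}
    (hbd : ∀ i, ∃ R : ℝ, ∀ n, ‖x n i‖ ≤ R) {a : ∀ i, X i}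
    (h : ∀ (k : ℕ → ℕ) (y : ∀ i, X i), Tendsto k atTop atTop →
      (∀ i, WeakTendsto (fun n => x (k n) i) (y i)) → y = a) (i : ι) :
    WeakTendsto (fun n => x n i) (a i) := by
  refine tendsto_of_subseq_tendsto fun ns hns => ?_
  obtain ⟨y, k, hk, hy⟩ := exists_weakTendsto_subseq_pi hX (u := fun n => x (ns n))
    fun i => (hbd i).imp fun R hR n => hR (ns n)
  refine ⟨k, ?_⟩
  have := h (fun n => ns (k n)) y (hns.comp hk.tendsto_atTop) hy
  exact this ▸ hy i

theorem existsUnique_isForwardBackward {γ : ℕ → ℝ}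
    (h : ∀ n i u, ∃ p, prox (f i) (fun z => (γ n : EReal) * φ i z) u = {p}) (x₀ : ∀ i, X i) :
    ∃! x : ℕ → ∀ i, X i, IsForwardBackward f φ ψ L γ x₀ x := by
  choose P hP using h
  let x : ℕ → ∀ i, X i := fun n => Nat.rec x₀ (fun n xn i => P n i (forwardStep f ψ L (γ n) xn i)) n
  refine ⟨x, ⟨rfl, fun n i => hP n i _⟩, fun y hy => funext fun n => ?_⟩
  induction n with
  | zero => exact hy.1
  | succ n ih =>
    funext i
    have h1 := hy.2 n i
    rw [ih, hP] at h1
    exact (Set.singleton_injective h1).symm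

end Iteration

end BregmanFB

end

/-! ### The convergence theorem. -/

theorem proposition4p2
    {ι κ : Type*} [Fintype ι] [Nonempty ι] [Fintype κ] [Nonempty κ]
    {X : ι → Type*} [∀ i, NormedAddCommGroup (X i)] [∀ i, NormedSpace ℝ (X i)]
    [∀ i, CompleteSpace (X i)]
    {Y : κ → Type*} [∀ k, NormedAddCommGroup (Y k)] [∀ k, NormedSpace ℝ (Y k)]
    [∀ k, CompleteSpace (Y k)]
    (hX : ∀ i, IsReflexiveSpace (X i)) (hY : ∀ k, IsReflexiveSpace (Y k))
    (φ : ∀ i, X i → EReal) (hφ : ∀ i, IsGammaZero (φ i))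
    (ψ : ∀ k, Y k → EReal) (hψ : ∀ k, IsGammaZero (ψ k))
    (hψ_int : ∀ k, (interior (effDom (ψ k))).Nonempty)
    (hψ_diff : ∀ k, ∀ y ∈ interior (effDom (ψ k)), GateauxDiffAt (ψ k) y)
    (L : ∀ i k, X i →L[ℝ] Y k)
    (σ : κ → ℝ) (hσ : ∀ k, 0 < σ k)
    (hsub : ∀ k, ∀ y v : ι → Y k,
      (∀ i, y i ∈ interior (effDom (ψ k))) → (∀ i, v i ∈ interior (effDom (ψ k))) →
      ∑ i, y i ∈ interior (effDom (ψ k)) → ∑ i, v i ∈ interior (effDom (ψ k)) →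
      bregman (ψ k) (∑ i, y i) (∑ i, v i) ≤ (σ k : EReal) * ∑ i, bregman (ψ k) (y i) (v i))
    (f : ∀ i, X i → EReal) (hf : ∀ i, IsGammaZero (f i)) (hfL : ∀ i, IsLegendre (f i))
    (hf_coer : ∀ i, ∀ x ∈ interior (effDom (f i)), IsCoerciveFun (bregman (f i) x))
    (hL : ∀ k, ∀ x : ∀ i, X i, (∀ i, x i ∈ interior (effDom (f i))) →
      ∑ i, L i k (x i) ∈ interior (effDom (ψ k)))
    (β : ι → κ → ℝ) (hβ : ∀ i k, 0 < β i k)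
    (hdom : ∀ i k, BregmanGE (f i) (fun z => (β i k : EReal) * ψ k (L i k z)))
    (hsol : (solutions φ ψ L ∩ Set.univ.pi fun i => interior (effDom (f i))).Nonempty)
    (hcof : (∀ i, IsCofinite (f i)) ∨ (∀ i, IsCofinite (φ i)))
    (S : ℝ) (hS : S = ∑ k, σ k * (Finset.univ.inf' Finset.univ_nonempty fun i => β i k)⁻¹)
    (ε : ℝ) (hε : 0 < ε) (hε' : ε < 1 / (1 + S))
    (η : ℕ → ℝ) (hη : ∀ n, 0 ≤ η n) (hη_sum : Summable η)
    (γ : ℕ → ℝ) (hγ : ∀ n, ε ≤ γ n ∧ γ n ≤ (1 - ε) / S)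
    (hγ' : ∀ n, (1 + η n) * γ n - γ (n + 1) ≤ η n / S)
    (x₀ : ∀ i, X i) (hx₀ : ∀ i, x₀ i ∈ interior (effDom (f i))) :
    (∃! x : ℕ → ∀ i, X i, IsForwardBackward f φ ψ L γ x₀ x) ∧
    ∀ x : ℕ → ∀ i, X i, IsForwardBackward f φ ψ L γ x₀ x →
      (∀ n i, x n i ∈ interior (effDom (f i))) ∧
      ∃ xbar ∈ solutions φ ψ L,
        ((∃ a, (solutions φ ψ L ∩ Set.univ.pi fun i => closure (effDom (f i))) = {a}) →
          ∀ i, WeakTendsto (fun n => x n i) (xbar i)) ∧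
        ((∀ i, GradWeakSeqCont (f i)) → (∀ k, GradWeakSeqCont (ψ k)) →
          (∀ i, effDom (φ i) ⊆ interior (effDom (f i)) ∨
            (IsOpen (effDom (conj (f i))) ∧ GradWeakSeqCont (conj (f i)))) →
          ∀ i, WeakTendsto (fun n => x n i) (xbar i)) := by
  obtain ⟨z₀, hz₀, hz₀f⟩ := hsol
  have hz₀i : ∀ i, z₀ i ∈ interior (effDom (f i)) := fun i => hz₀f i (Set.mem_univ i)
  obtain ⟨hz₀φ, hz₀ψ⟩ := mem_effDom_of_objective_lt_top hφ hψ hz₀.1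
  have hγ0 : ∀ n, 0 < γ n := fun n => hε.trans_le (hγ n).1
  refine ⟨existsUnique_isForwardBackward (fun n i u =>
    (hfL i).prox_const_mul_eq_singleton (hX i) (hf i) (hφ i) (hcof.imp (· i) (· i)) (hz₀i i)
      (hz₀φ i) (hγ0 n) u) x₀, fun x hx => ?_⟩
  have hstep := fun n i => (hfL i).of_mem_prox_const_mul (hf i) (hφ i) (hz₀i i) (hz₀φ i) (hγ0 n)
    (by rw [hx.2 n i]; exact Set.mem_singleton (x (n + 1) i))
  have hxi : ∀ n i, x n i ∈ interior (effDom (f i)) := by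
    rintro (_ | n) i
    · rw [hx.1]
      exact hx₀ i
    · exact (hstep n i).1
  refine ⟨hxi, ?_⟩
  have hS0 : 0 < S := by
    rw [hS]
    exact Finset.sum_pos (fun k _ => mul_pos (hσ k)
      (inv_pos.2 ((Finset.lt_inf'_iff _).2 fun i _ => hβ i k))) Finset.univ_nonempty
  have hsmooth : ∀ n, ∑ k, realBregman (ψ k) (∑ i, L i k (x (n + 1) i)) (∑ i, L i k (x n i)) ≤
      S * ∑ i, realBregman (f i) (x (n + 1) i) (x n i) := fun n => by
    rw [hS]
    exact sum_realBregman_le hψ hψ_int hψ_diff hσ hsub hf hfL hL hβ hdom (hxi (n + 1)) (hxi n)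
  have hLx : ∀ n k, ∑ i, L i k (x n i) ∈ interior (effDom (ψ k)) := fun n k => hL k _ (hxi n)
  have hobj : ∀ n, objective φ ψ L (x (n + 1)) = (realObjective φ ψ L (x (n + 1)) : EReal) :=
    fun n => objective_eq_coe hφ hψ (fun i => (hstep n i).2.1)
      fun k => interior_subset (hLx (n + 1) k)
  have hnonneg : ∀ (z : ∀ i, X i), (∀ i, z i ∈ effDom (f i)) → ∀ n i,
      0 ≤ realBregman (f i) (z i) (x n i) := fun z hz n i =>
    (hf i).realBregman_nonneg (hz i) ((hfL i).gateaux _ (hxi n i))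
  have hdescent : ∀ z ∈ solutions φ ψ L, (∀ i, z i ∈ effDom (f i)) →
      (∃ l, Tendsto (fun n => ∑ i, realBregman (f i) (z i) (x n i)) atTop (𝓝 l)) ∧
      Tendsto (fun n => realObjective φ ψ L (x (n + 1)) - realObjective φ ψ L z) atTop (𝓝 0) ∧
      ∀ n, ∑ i, realBregman (f i) (z i) (x (n + 1) i) ≤ ∑ i, realBregman (f i) (z i) (x n i) := by
    intro z hz hzf
    obtain ⟨hzφ, hzψ⟩ := mem_effDom_of_objective_lt_top hφ hψ hz.1
    have hge : ∀ n, 0 ≤ realObjective φ ψ L (x (n + 1)) - realObjective φ ψ L z := fun n => by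
      have := hz.2 (x (n + 1))
      rw [hobj, objective_eq_coe hφ hψ hzφ hzψ, EReal.coe_le_coe_iff] at this
      linarith
    have hdec : ∀ n, ε * (realObjective φ ψ L (x (n + 1)) - realObjective φ ψ L z) +
        ∑ i, realBregman (f i) (z i) (x (n + 1) i) ≤ ∑ i, realBregman (f i) (z i) (x n i) := by
      intro n
      have h := descent_step (f := f) (φ := φ) (S := S) hψ (hγ0 n).le
        (fun k => hψ_diff k _ (hLx n k)) (fun i => (hstep n i).2.2 (z i) (hzφ i))
        (hsmooth n) hzψ
      have h1 : 0 ≤ (1 - γ n * S) * ∑ i, realBregman (f i) (x (n + 1) i) (x n i) := by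
        refine mul_nonneg ?_ (Finset.sum_nonneg fun i _ =>
          hnonneg _ (fun i => interior_subset (hxi (n + 1) i)) n i)
        have := (le_div_iff₀ hS0).1 (hγ n).2
        linarith
      have h2 := mul_le_mul_of_nonneg_right (hγ n).1 (hge n)
      linarith
    obtain ⟨h1, h2⟩ := tendsto_of_decrease hε
      (fun n => Finset.sum_nonneg fun i _ => hnonneg z hzf n i) hge hdec
    exact ⟨h1, h2, fun n => by linarith [hdec n, mul_nonneg hε.le (hge n)]⟩
  obtain ⟨-, hlim₀, hanti₀⟩ := hdescent z₀ hz₀ fun i => interior_subset (hz₀i i)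
  have hD₀ : ∀ n i, realBregman (f i) (z₀ i) (x n i) ≤ ∑ i, realBregman (f i) (z₀ i) (x 0 i) :=
    fun n i => (Finset.single_le_sum
      (fun i _ => hnonneg z₀ (fun i => interior_subset (hz₀i i)) n i) (Finset.mem_univ i)).trans
      (antitone_nat_of_succ_le (f := fun n => ∑ i, realBregman (f i) (z₀ i) (x n i)) hanti₀
        (Nat.zero_le n))
  have hbd : ∀ i, ∃ R : ℝ, ∀ n, ‖x n i‖ ≤ R := fun i => by
    obtain ⟨R, hR⟩ := exists_norm_le_of_coercive (hf i).ne_bot (interior_subset (hz₀i i))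
      (hf_coer i _ (hz₀i i)) (∑ i, realBregman (f i) (z₀ i) (x 0 i))
    exact ⟨R, fun n => hR _ (hxi n i) (hD₀ n i)⟩
  -- The index is shifted because the starting point need not lie in dom φ, so its objective value
  -- may be infinite.
  have hobjlim : Tendsto (fun n => objective φ ψ L (x n)) atTop (𝓝 (objective φ ψ L z₀)) := by
    rw [← tendsto_add_atTop_iff_nat 1, objective_eq_coe hφ hψ hz₀φ hz₀ψ]
    simp only [hobj]
    refine continuous_coe_real_ereal.continuousAt.tendsto.comp ?_
    simpa using hlim₀.add_const (realObjective φ ψ L z₀)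
  have hcluster : ∀ (k : ℕ → ℕ) (y : ∀ i, X i), Tendsto k atTop atTop →
      (∀ i, WeakTendsto (fun n => x (k n) i) (y i)) → y ∈ solutions φ ψ L :=
    fun k y hk hy => mem_solutions_of_weakTendsto hφ hψ hz₀ hy (hobjlim.comp hk)
  -- One limit point must serve both assertions, so it is chosen according to which hypotheses hold;
  -- when neither set does, both assertions are vacuous and z₀ will do.
  by_cases h1 : ∃ a, (solutions φ ψ L ∩ Set.univ.pi fun i => closure (effDom (f i))) = {a}
  · obtain ⟨a, ha⟩ := h1
    have haF : a ∈ solutions φ ψ L := (ha.symm.subset (Set.mem_singleton a)).1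
    have hconv : ∀ i, WeakTendsto (fun n => x n i) (a i) :=
      weakTendsto_of_unique_cluster hX hbd fun k y hk hy => by
        have hmem : y ∈ solutions φ ψ L ∩ Set.univ.pi fun i => closure (effDom (f i)) :=
          ⟨hcluster k y hk hy, fun i _ => mem_of_weakTendsto (hf i).convex_effDom.closure
            isClosed_closure (hy i) fun n => subset_closure (interior_subset (hxi (k n) i))⟩
        rwa [ha] at hmem
    exact ⟨a, haF, fun _ => hconv, fun _ _ _ => hconv⟩
  by_cases h2 : (∀ i, GradWeakSeqCont (f i)) ∧ ∀ i, effDom (φ i) ⊆ interior (effDom (f i)) ∨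
      (IsOpen (effDom (conj (f i))) ∧ GradWeakSeqCont (conj (f i)))
  · obtain ⟨hweak, hab⟩ := h2
    have hint : ∀ (k : ℕ → ℕ) (y : ∀ i, X i), Tendsto k atTop atTop →
        (∀ i, WeakTendsto (fun n => x (k n) i) (y i)) → ∀ i, y i ∈ interior (effDom (f i)) := by
      intro k y hk hy i
      rcases hab i with h | ⟨hopen, hw⟩
      · exact h ((mem_effDom_of_objective_lt_top hφ hψ (hcluster k y hk hy).1).1 i)
      · exact (hfL i).mem_interior_of_weakTendsto (hX i) (hf i) hopen hw (hz₀i i)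
          (fun n => hxi (k n) i) (fun n => hD₀ (k n) i) (hy i)
    obtain ⟨a, j, hj, hja⟩ := exists_weakTendsto_subseq_pi hX hbd
    have haF := hcluster j a hj.tendsto_atTop hja
    have hai := hint j a hj.tendsto_atTop hja
    obtain ⟨⟨l, hl⟩, -⟩ := hdescent a haF fun i => interior_subset (hai i)
    have hconv : ∀ i, WeakTendsto (fun n => x n i) (a i) :=
      weakTendsto_of_unique_cluster hX hbd fun k y hk hy => by
        have hyi := hint k y hk hy
        obtain ⟨⟨l', hl'⟩, -⟩ := hdescent y (hcluster k y hk hy) fun i => interior_subset (hyi i)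
        exact eq_of_weakTendsto_of_tendsto_realBregman hf hfL hweak hxi hyi hai hl' hl hk
          hj.tendsto_atTop hy hja
    exact ⟨a, haF, fun _ => hconv, fun _ _ _ => hconv⟩
  · exact ⟨z₀, hz₀, fun h => absurd h h1, fun hw _ hab => absurd ⟨hw, hab⟩ h2⟩
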